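/- **Setting.** Let $G=(V,E)$ be a finite connected symmetric directed multigraph with $n=|V|$ vertices and $m=|E|$ arcs: every arc $e=(u,v)$ has an opposite arc $-e=(v,u)$ with $-(-e)=e$; parallel arcs and self-loops are allowed, and a loop is its own opposite. The outgoing arcs of every vertex are arranged in a fixed cyclic order. In the round-robin (RR) dynamics a state consists of a pointer to one outgoing arc at each vertex and a number of tokens at each vertex, $k$ tokens in total. In each synchronous step every vertex sends out all its tokens one by one: each token is sent along the arc currently pointed to, and the pointer is then advanced to the next outgoing arc in the cyclic order; all tokens sent out arrive at their targets at the beginning of the next step. Let $L_t(e)$ be the number of tokens sent along the arc $e$ in step $t$, and let $C_t^{\Delta}(e)=\sum_{0\le i<\Delta}L_{t+i}(e)$. Put $\mathrm{idle}(t,e)=\min\{\Delta : C_t^{\Delta}(e)\ge 1\}$ (with $\min\emptyset=\infty$), $\mathrm{idle}(e)=\limsup_{t\to\infty}\mathrm{idle}(t,e)$, and let $\mathrm{idle}(G)=\max_{e\in E}\mathrm{idle}(e)$ be the idleness of the dynamics. (Because of the limsup, only the recurrent phase of the dynamics matters.) Let $\mathrm{diam}(G)$ be the largest distance between two vertices of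 $G$. **Proposition.** There are absolute constants $C$ and $p$ such that the following holds for every such $G$, all cyclic orders, every $k$ with $1\le k\le m$, and every initial state with $k$ tokens. If $G$ is not bipartite (i.e. $V$ has no 2-colouring in which every arc, loops included, joins vertices of different colours), then - $\mathrm{idle}(G)\le C\,(1+\log m)^p\cdot\frac{m}{k}\gcd(k,m)$; - $\mathrm{idle}(G)\le C\cdot\frac{m}{k}\max(1,\mathrm{diam}(G))$; - $\mathrm{idle}(G)\le C\,(1+\log m)^p\cdot\frac{m}{k}\sqrt{n}$; - $\mathrm{idle}(G)\le 4$ if $k>\frac34 m$; - $\mathrm{idle}(G)\le C\,(1+\log m)^p\cdot\frac{m}{k}\sqrt{k}$. If $G$ is a tree (each undirected edge being represented by its two opposite arcs, with no loops or parallel arcs), then - $\mathrm{idle}(G)\le C\cdot\frac{m}{k}$. -/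

import Mathlib

open scoped ENNReal

/-- A symmetric directed multigraph with vertex type `V` and arc type `E`. Parallel arcs and
self-loops are allowed. Every arc has an opposite arc; a loop is its own opposite. -/
structure SymDigraph (V E : Type*) where
  src : E → V
  tgt : E → V
  rev : E → E
  rev_rev : ∀ e, rev (rev e) = e
  src_rev : ∀ e, src (rev e) = tgt e
  rev_loop : ∀ e, src e = tgt e → rev e = e

namespace SymDigraph

variable {V E : Type*}

theorem tgt_rev (G : SymDigraph V E) (e : E) : G.tgt (G.rev e) = G.src e := by
  rw [← G.src_rev, G.rev_rev]

/-- The simple graph obtained by forgetting loops and the multiplicities and directions of arcs.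
It has the same connectivity and the same distances as `G`. -/
def toSimple (G : SymDigraph V E) : SimpleGraph V where
  Adj u v := u ≠ v ∧ ∃ e, G.src e = u ∧ G.tgt e = v
  symm := ⟨by
    rintro u v ⟨h, e, rfl, rfl⟩
    exact ⟨h.symm, G.rev e, G.src_rev e, G.tgt_rev e⟩⟩
  loopless := ⟨fun _ h => h.1 rfl⟩

def Connected (G : SymDigraph V E) : Prop := G.toSimple.Connected

/-- `G` is bipartite: there is a 2-colouring of the vertices such that every arc (loops included)
joins vertices of different colours. -/
def IsBipartite (G : SymDigraph V E) : Prop :=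
  ∃ c : V → Bool, ∀ e, c (G.src e) ≠ c (G.tgt e)

/-- `G` is a tree: it has no loops and no parallel arcs, and its underlying undirected graph is
a tree. -/
def IsTree (G : SymDigraph V E) : Prop :=
  (∀ e, G.src e ≠ G.tgt e) ∧
  (∀ e f, G.src e = G.src f → G.tgt e = G.tgt f → e = f) ∧
  G.toSimple.IsTree

/-- The diameter of `G`: the largest distance between two vertices. -/
noncomputable def diam (G : SymDigraph V E) : ℕ := G.toSimple.diam

/-- Cyclic orderings of the outgoing arcs of all vertices, given by the successor map: the cycles
of the permutation `next` are exactly the sets of arcs with a common source. -/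
structure RoundRobin (G : SymDigraph V E) where
  next : Equiv.Perm E
  sameCycle_iff : ∀ e f, next.SameCycle e f ↔ G.src e = G.src f

/-- A state of the round-robin dynamics: a current outgoing arc (port pointer) at every vertex and
a number of tokens at every vertex. -/
structure State (G : SymDigraph V E) where
  pointer : V → E
  src_pointer : ∀ v, G.src (pointer v) = v
  tokens : V → ℕ

/-- The total number of tokens. -/
def State.total [Fintype V] {G : SymDigraph V E} (x : G.State) : ℕ := ∑ v, x.tokens v

namespace RoundRobin

variable {G : SymDigraph V E}

theorem src_next_pow (R : G.RoundRobin) (i : ℕ) (e : E) : G.src ((R.next ^ i) e) = G.src e :=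
  ((R.sameCycle_iff e ((R.next ^ i) e)).1 ⟨i, by simp⟩).symm

open Classical in
/-- The number of tokens sent along the arc `e` in one step from the state `x`. The tokens at a
vertex `v` are sent one by one, the pointer advancing after each of them, so that the token
number `i` (counted from `0`) is sent along `next ^ i` applied to the initial pointer at `v`. -/
noncomputable def load (R : G.RoundRobin) (x : G.State) (e : E) : ℕ :=
  ((Finset.range (x.tokens (G.src e))).filter
    (fun i => (R.next ^ i) (x.pointer (G.src e)) = e)).card

open Classical in
/-- One synchronous step: every vertex sends out all its tokens, its pointer advances once for each
of them, and each token arrives at the target of the arc along which it was sent. -/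
noncomputable def step [Fintype E] (R : G.RoundRobin) (x : G.State) : G.State where
  pointer v := (R.next ^ (x.tokens v)) (x.pointer v)
  src_pointer v := by rw [R.src_next_pow, x.src_pointer]
  tokens v := ∑ e ∈ Finset.univ.filter (fun e => G.tgt e = v), R.load x e

/-- The number of tokens traversing `e` at time step `t`, starting from the state `x` at time `0`. -/
noncomputable def loadAt [Fintype E] (R : G.RoundRobin) (x : G.State) (t : ℕ) (e : E) : ℕ :=
  R.load (R.step^[t] x) e

/-- The cumulated load of `e` over the `Δ` time steps `t, …, t + Δ - 1`. -/
noncomputable def cumLoad [Fintype E] (R : G.RoundRobin) (x : G.State) (t Δ : ℕ) (e : E) : ℕ :=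
  ∑ i ∈ Finset.range Δ, R.loadAt x (t + i) e

/-- The idle time of `e` at time `t`: the least `Δ` such that `e` is visited in one of the `Δ` time
steps from `t` on (`⊤` if `e` is not visited any more). -/
noncomputable def idleTime [Fintype E] (R : G.RoundRobin) (x : G.State) (t : ℕ) (e : E) : ℕ∞ :=
  ⨅ (Δ : ℕ) (_ : 1 ≤ R.cumLoad x t Δ e), (Δ : ℕ∞)

noncomputable def arcIdleness [Fintype E] (R : G.RoundRobin) (x : G.State) (e : E) : ℕ∞ :=
  Filter.limsup (fun t => R.idleTime x t e) Filter.atTop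

/-- The idleness of the dynamics started from `x`: the largest idleness of an arc. -/
noncomputable def idleness [Fintype E] (R : G.RoundRobin) (x : G.State) : ℕ∞ :=
  ⨆ e, R.arcIdleness x e

end RoundRobin

end SymDigraph

/-!
Only the recurrent phase matters for the idleness, and there the dynamics is a mere transport of
tokens. For every window length, the sum of the squares of the loads accumulated by the arcs in a
time window never increases, since a round-robin vertex redistributes what it receives as evenly as
possible. As the dynamics is eventually periodic, the sum is finally constant, which forces the loads
arriving at a vertex to be as even as those leaving it, in every time window
(`exists_balanced_of_periodic`). Arcs with a common target, or with a common source, are then totally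
ordered by their accumulated loads, and matching them in this order shows that the tokens travel
along the orbits of a permutation `σ` of the arcs, the *subcycles* (`exists_subcycles`). The only
trace of the round-robin rule is that arcs leaving the same vertex carry the same load, up to one
token, in every time window.

So idleness is a matter of empty windows on subcycles. Write `Near r e f` if corresponding windows
starting at `e` and at `f` differ by at most `r` tokens. This is subadditive in `r`, costs `1` for
arcs with a common source, and is invariant under moving both arcs along their subcycles. All
subcycles have the same density `k / m` of tokens. If `e` is near its own shift by `d` at cost `r`,
then the windows of length `d` on its subcycle vary by at most `r`, because exchanging window length
and delay does not change the difference of two windows (`win_add_win_shift`); as their average is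
`d k / m`, an empty one forces `d < r m / k` (`mul_lt_of_near`). If moreover all delays cost at most
`r`, then every window of length `r m / k + 3` contains a token (`one_le_win_of_lag`). It remains
to find cheap delays.

* A delay of `4` costs `3`, by comparison through the reversed arcs. This settles `k > 3 m / 4`.
* Each step of a walk in the graph costs `2`, and can be taken so as to gain or to lose a time unit,
  so all delays cost `2 diam G + 1` up to one time unit (`near_of_walk`).
* In a tree, a subcycle that leaves a vertex through a neighbour first returns through the same
  neighbour. This self-similarity produces returns to some vertex, hence delays of cost `1`, at every
  scale (`exists_eq_of_first_return`).

For the remaining bounds, suppose that every subcycle is at discrepancy at most `h` from a point of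
the subcycle of `e`. Then all delays on the latter cost at most `h` times a power of `log m`
(`lag_of_reach`). Indeed, the delays of a subcycle of length `l` form the group `ZMod l`, and if a
character `χ` of it is close to `1` on all delays of cost `2 h + 1`, then it gives every vertex an
approximate position on the circle. The displacements along two opposite arcs cancel, while the
displacements along all subcycles add up to `m` times the angle of `χ (-1)`; hence `χ` is trivial
(`addChar_eq_zero_of_lag`). A set of delays on which no nontrivial character is close to `1`
generates the group in polylogarithmically many steps, by Fourier inversion
(`exists_sum_eq_of_addChar`).

The number `h` is at most the diameter of the graph of subcycles, two of them being adjacent if they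
share a vertex. Every subcycle has a length divisible by `m / gcd k m`, so that there are at most
`gcd k m` of them. On a geodesic of the graph, the tokens of all subcycles, and the vertices of every
second one, are disjoint. So either the diameter is `O(√k)`, or a subcycle with at most `√k` tokens
is within distance `O(√k)`; on that one all delays are cheap, for trivial reasons. The same
alternative holds with `n` vertices in place of `k` tokens, as even delays on a subcycle cost at most
three times the number of its vertices (`near_shift_of_card_le`).
-/

/-! ### Subcycle decompositions -/

namespace SymDigraph

variable {V E : Type*}

/-- A subcycle decomposition of `G` carrying a periodic load. The permutation `σ` matches each arc
entering a vertex with an arc leaving it, so that its orbits are closed trails covering every arc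
once, and `w e` is the number of tokens on `e` at time `0`; at each step all tokens move from `e`
to `σ e`. The field `balanced` says that arcs with a common source carry, up to one token, the same
load in every time window. (Time runs against `σ` along a fixed arc: the load of `e` at time `t` is
`w (σ ^ (-t) e)`.) The field `out` records that every vertex has an outgoing arc. -/
structure Subcycles (G : SymDigraph V E) where
  σ : Equiv.Perm E
  w : E → ℕ
  out : V → E
  src_out : ∀ v, G.src (out v) = v
  src_σ : ∀ e, G.src (σ e) = G.tgt e
  balanced : ∀ e f, G.src e = G.src f → ∀ (z : ℤ) (Δ : ℕ),
    ∑ i ∈ Finset.range Δ, w ((σ ^ (z + i)) e) ≤ ∑ i ∈ Finset.range Δ, w ((σ ^ (z + i)) f) + 1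

namespace Subcycles

variable {G : SymDigraph V E} (S : G.Subcycles)

/-- The arc reached from `e` after `z` steps along its subcycle. -/
def shift (z : ℤ) (e : E) : E := (S.σ ^ z) e

@[simp] theorem shift_zero (e : E) : S.shift 0 e = e := by simp [shift]

theorem shift_one (e : E) : S.shift 1 e = S.σ e := by simp [shift]

theorem shift_shift (a b : ℤ) (e : E) : S.shift a (S.shift b e) = S.shift (a + b) e := by
  simp [shift, zpow_add]

theorem src_shift_add_one (z : ℤ) (e : E) : G.src (S.shift (z + 1) e) = G.tgt (S.shift z e) := by
  rw [add_comm, ← shift_shift, shift_one, S.src_σ]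

/-- The total load of the `Δ` consecutive arcs `e, σ e, …, σ ^ (Δ - 1) e`. -/
def win (Δ : ℕ) (e : E) : ℕ := ∑ i ∈ Finset.range Δ, S.w (S.shift i e)

theorem win_zero (e : E) : S.win 0 e = 0 := by simp [win]

theorem win_add (a b : ℕ) (e : E) : S.win (a + b) e = S.win a e + S.win b (S.shift a e) := by
  simp only [win, Finset.sum_range_add, shift_shift]
  congr 1
  refine Finset.sum_congr rfl fun i _ => ?_
  congr 2; push_cast; ring

theorem win_mono {a b : ℕ} (h : a ≤ b) (e : E) : S.win a e ≤ S.win b e := by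
  obtain ⟨c, rfl⟩ := Nat.exists_eq_add_of_le h
  rw [win_add]; omega

/-- `e` and `f` stay at discrepancy at most `r`: all equally long windows starting at
corresponding places of their subcycles carry the same load up to `r`. -/
def Near (r : ℕ) (e f : E) : Prop :=
  ∀ (z : ℤ) (Δ : ℕ), S.win Δ (S.shift z e) ≤ S.win Δ (S.shift z f) + r ∧
    S.win Δ (S.shift z f) ≤ S.win Δ (S.shift z e) + r

variable {S}

theorem Near.refl (e : E) : S.Near 0 e e := fun _ _ => ⟨le_rfl, le_rfl⟩

theorem Near.symm {r : ℕ} {e f : E} (h : S.Near r e f) : S.Near r f e := fun z Δ => (h z Δ).symm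

theorem Near.trans {r s : ℕ} {e f g : E} (h : S.Near r e f) (h' : S.Near s f g) :
    S.Near (r + s) e g := fun z Δ => by
  have h1 := h z Δ
  have h2 := h' z Δ
  omega

theorem Near.mono {r s : ℕ} {e f : E} (h : S.Near r e f) (hrs : r ≤ s) : S.Near s e f :=
  fun z Δ => by
  have h1 := h z Δ
  omega

theorem Near.shift {r : ℕ} {e f : E} (h : S.Near r e f) (a : ℤ) :
    S.Near r (S.shift a e) (S.shift a f) := fun z Δ => by
  simpa only [shift_shift] using h (z + a) Δ

theorem near_of_src {e f : E} (h : G.src e = G.src f) : S.Near 1 e f := fun z Δ => by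
  have h1 := S.balanced e f h z Δ
  have h2 := S.balanced f e h.symm z Δ
  simp only [win, Subcycles.shift_shift]
  simp only [Subcycles.shift, add_comm _ z]
  exact ⟨h1, h2⟩

/-- The arc `-e` enters the source of `e`, so that its successor competes with `e`. -/
theorem near_shift_rev (e : E) : S.Near 1 e (S.shift 1 (G.rev e)) := by
  apply near_of_src
  rw [shift_one, S.src_σ, G.tgt_rev]

theorem near_rev_shift (e : E) : S.Near 1 (G.rev e) (S.shift 1 e) := by
  apply near_of_src
  rw [shift_one, S.src_σ, G.src_rev]

theorem near_shift_two (e : E) : S.Near 2 e (S.shift 2 e) := by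
  have h := (near_shift_rev (S := S) e).trans ((near_rev_shift e).shift 1)
  rwa [shift_shift] at h

/-- Passing through both reversed arcs, `e ∼ σ (-e) ∼ σ ^ 2 (-(σ e)) ∼ σ ^ 4 e`, takes one
comparison fewer than applying `near_shift_two` twice. -/
theorem near_shift_four (e : E) : S.Near 3 e (S.shift 4 e) := by
  have h1 := near_shift_rev (S := S) e
  have h2 : S.Near 1 (G.rev e) (S.shift 1 (G.rev (S.shift 1 e))) := by
    apply near_of_src
    rw [shift_one, S.src_σ, G.tgt_rev, G.src_rev, shift_one, S.src_σ]
  have h3 := near_rev_shift (S := S) (S.shift 1 e)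
  have h := (h1.trans (h2.shift 1)).trans (h3.shift 2)
  simpa only [shift_shift, show (1 : ℤ) + 1 = 2 by norm_num, show (2 : ℤ) + 2 = 4 by norm_num,
    show (2 : ℤ) + (1 + 1) = 4 by norm_num] using h

/-- Exchanging the roles of the two lengths: comparing windows of length `Δ` at distance `d` is the
same as comparing windows of length `d` at distance `Δ`. -/
theorem win_add_win_shift (a b : ℕ) (e : E) :
    S.win a e + S.win b (S.shift a e) = S.win b e + S.win a (S.shift b e) := by
  rw [← win_add, ← win_add, add_comm]

theorem win_mul {l : ℕ} {e : E} (h : S.shift l e = e) (n : ℕ) : S.win (n * l) e = n * S.win l e := by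
  induction n with
  | zero => simp [win_zero]
  | succ n ih =>
    rw [Nat.succ_mul, add_comm, win_add, h, ih]; ring

theorem shift_shift_eq {l : ℕ} {e : E} (h : S.shift l e = e) (z : ℤ) :
    S.shift l (S.shift z e) = S.shift z e := by
  rw [shift_shift, add_comm, ← shift_shift, h]

variable (S) in
/-- A common period of all subcycles. -/
noncomputable def period : ℕ := orderOf S.σ

theorem shift_period (e : E) : S.shift S.period e = e := by
  simp [Subcycles.shift, period, pow_orderOf_eq_one]

theorem shift_period_mul (j : ℤ) (e : E) : S.shift (j * S.period) e = e := by
  simp [Subcycles.shift, period, mul_comm j, zpow_mul, pow_orderOf_eq_one]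

section Period

variable [Fintype E]

theorem period_pos : 0 < S.period := orderOf_pos _

theorem exists_shift_nat (z : ℤ) (e : E) : ∃ n : ℕ, S.shift z e = S.shift n e := by
  have hp : (0 : ℤ) < S.period := by exact_mod_cast period_pos
  refine ⟨(z % S.period).toNat, ?_⟩
  rw [Int.toNat_of_nonneg (Int.emod_nonneg _ hp.ne')]
  conv_lhs => rw [← Int.emod_add_mul_ediv z S.period, mul_comm, ← shift_shift, shift_period_mul]

theorem win_shift_of_shift_eq {l : ℕ} {e : E} (h : S.shift l e = e) (z : ℤ) :
    S.win l (S.shift z e) = S.win l e := by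
  obtain ⟨n, hn⟩ := exists_shift_nat (S := S) z e
  have h1 := win_add_win_shift (S := S) l n e
  rw [h] at h1
  rw [hn]; omega

omit [Fintype E] in
theorem win_period_congr {r : ℕ} {e f : E} (h : S.Near r e f) :
    S.win S.period e = S.win S.period f := by
  -- the two loads grow linearly with the number of turns, so a bounded difference is zero
  have h1 := h 0 ((r + 1) * S.period)
  simp only [shift_zero, win_mul (shift_period _)] at h1
  rcases lt_trichotomy (S.win S.period e) (S.win S.period f) with h2 | h2 | h2
  · nlinarith [h1.2]
  · exact h2
  · nlinarith [h1.1]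

theorem sum_win (Δ : ℕ) : ∑ e, S.win Δ e = Δ * ∑ e, S.w e := by
  simp only [win]
  rw [Finset.sum_comm]
  have : ∀ i : ℕ, ∑ e, S.w (S.shift i e) = ∑ e, S.w e := fun i =>
    Equiv.sum_comp (S.σ ^ (i : ℤ)) S.w
  simp [this]

/-- Along an orbit, the average load of a window does not depend on the window length. -/
theorem sum_range_win (d : ℕ) (e : E) :
    ∑ i ∈ Finset.range S.period, S.win d (S.shift i e) = d * S.win S.period e := by
  induction d with
  | zero => simp [win_zero]
  | succ d ih =>
    have : ∀ i : ℕ, S.win (d + 1) (S.shift i e) = S.win d (S.shift i e) +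
        S.w (S.shift i (S.shift d e)) := fun i => by
      rw [win_add]
      simp [win, shift_shift, add_comm]
    simp only [this, Finset.sum_add_distrib, ih]
    rw [show ∑ i ∈ Finset.range S.period, S.w (S.shift i (S.shift d e)) =
      S.win S.period (S.shift d e) from rfl, win_shift_of_shift_eq (shift_period e)]
    ring

end Period

end Subcycles

end SymDigraph

/-! ### Density of tokens and the cost of delays -/

namespace SymDigraph

namespace Subcycles

variable {V E : Type*} {G : SymDigraph V E} {S : G.Subcycles}

/-- Each step along an arc `a` costs `2`, and may be chosen to gain or to lose one time unit:
either the reverse arc `-a` or the successor of `a` is used for the comparison. Hence the delay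
can be kept in `{0, 1}`. -/
theorem near_of_walk {u v : V} (p : G.toSimple.Walk u v) : ∀ e f : E, G.src e = u → G.src f = v →
    ∃ j : ℤ, (j = 0 ∨ j = 1) ∧ S.Near (2 * p.length + 1) e (S.shift j f) := by
  induction p with
  | nil =>
    intro e f he hf
    exact ⟨0, Or.inl rfl, by simpa using near_of_src (he.trans hf.symm)⟩
  | cons h p ih =>
    intro e f he hf
    rw [SimpleGraph.Walk.length_cons]
    obtain ⟨-, a, ha, ha'⟩ := h
    obtain ⟨j, hj, h⟩ := ih (G.rev a) f (by rw [G.src_rev, ha']) hf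
    have h1 : S.Near 1 e a := near_of_src (he.trans ha.symm)
    rcases hj with rfl | rfl
    · refine ⟨1, Or.inr rfl, ?_⟩
      have h2 := (h1.trans (near_shift_rev a)).trans (h.shift 1)
      rw [shift_shift] at h2
      exact h2.mono (by omega)
    · refine ⟨0, Or.inl rfl, ?_⟩
      have h2 := (near_rev_shift (S := S) a).symm.shift (-1)
      rw [shift_shift] at h2
      have h3 := h.shift (-1)
      rw [shift_shift] at h3
      norm_num at h2 h3 ⊢
      exact ((h1.trans h2).trans h3).mono (by omega)

variable [Fintype E]

theorem card_mul_win_period (hG : G.Connected) (e : E) :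
    Fintype.card E * S.win S.period e = S.period * ∑ f, S.w f := by
  rw [← sum_win]
  have : ∀ f, S.win S.period f = S.win S.period e := fun f => by
    obtain ⟨p⟩ := hG.preconnected (G.src e) (G.src f)
    obtain ⟨j, -, h⟩ := near_of_walk (S := S) p e f rfl rfl
    rw [win_period_congr h, win_shift_of_shift_eq (shift_period f)]
  simp [this]

/-- All subcycles have the same density of tokens. -/
theorem card_mul_win (hG : G.Connected) {l : ℕ} {e : E} (h : S.shift l e = e) :
    Fintype.card E * S.win l e = l * ∑ f, S.w f := by
  have h1 := card_mul_win_period (S := S) hG e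
  have h2 := win_mul h S.period
  have h3 := win_mul (shift_period (S := S) e) l
  rw [mul_comm l, h2] at h3
  apply Nat.eq_of_mul_eq_mul_left (period_pos (S := S))
  calc _ = Fintype.card E * (S.period * S.win l e) := by ring
    _ = l * (Fintype.card E * S.win S.period e) := by rw [h3]; ring
    _ = _ := by rw [h1]; ring

omit [Fintype E] in
theorem win_shift_le_of_near {r d : ℕ} {e : E} (h : S.Near r e (S.shift d e)) (n : ℕ) :
    S.win d (S.shift n e) ≤ S.win d e + r := by
  have h1 := win_add_win_shift (S := S) n d e
  have h2 := h 0 n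
  simp only [shift_zero] at h2
  omega

/-- If the delay `d` has cost `r`, then the loads of the windows of length `d` on the subcycle of
`e` vary by at most `r`. So an empty window forces a small average. -/
theorem mul_lt_of_near (hG : G.Connected) {r d : ℕ} (hr : 1 ≤ r) {e : E}
    (h : S.Near r e (S.shift d e)) (h0 : S.win d e = 0) :
    d * ∑ f, S.w f < r * Fintype.card E := by
  have h1 : ∑ i ∈ Finset.range S.period, S.win d (S.shift i e) <
      ∑ i ∈ Finset.range S.period, r := by
    apply Finset.sum_lt_sum
    · intro i _
      have := win_shift_le_of_near h i
      omega
    · exact ⟨0, by simpa using period_pos, by simp [h0]; omega⟩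
  rw [sum_range_win, Finset.sum_const, Finset.card_range, smul_eq_mul] at h1
  have hm : 0 < Fintype.card E := Fintype.card_pos_iff.2 ⟨e⟩
  have h2 := card_mul_win_period (S := S) hG e
  have h3 := Nat.mul_lt_mul_of_pos_left h1 hm
  have hp := period_pos (S := S)
  apply lt_of_mul_lt_mul_left (a := S.period) _ (Nat.zero_le _)
  calc _ = d * (S.period * ∑ f, S.w f) := by ring
    _ = Fintype.card E * (d * S.win S.period e) := by rw [← h2]; ring
    _ < _ := h3
    _ = _ := by ring

theorem one_le_win_four (hG : G.Connected) (hk : 3 * Fintype.card E < 4 * ∑ f, S.w f) (e : E) :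
    1 ≤ S.win 4 e := by
  by_contra h0
  have := mul_lt_of_near (S := S) hG (by norm_num) (d := 4) (near_shift_four e) (by omega)
  omega

omit [Fintype E] in
variable (S) in
/-- The delay `z` on the subcycle of `e` costs at most `r`, up to one time unit. The tolerance makes
parity obstructions disappear, and it is harmless because the load of a window grows with it. -/
def Lag (r : ℕ) (e : E) (z : ℤ) : Prop :=
  ∃ j : ℤ, |j| ≤ 1 ∧ S.Near r e (S.shift (z + j) e)

/-- If every delay costs at most `r`, all windows of some length a little less than that of an
empty window carry at most `r` tokens, which bounds the length of an empty window. -/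
theorem one_le_win_of_lag (hG : G.Connected) (hk : 1 ≤ ∑ f, S.w f) {r : ℕ} {e : E}
    (h : ∀ z, S.Lag r e z) :
    1 ≤ S.win (r * Fintype.card E / (∑ f, S.w f) + 3) e := by
  set k := ∑ f, S.w f with hk_def
  set q := r * Fintype.card E / k
  by_contra h0
  have h0 : S.win (q + 3) e = 0 := by omega
  have h1 : ∀ i : ℕ, S.win (q + 1) (S.shift i e) ≤ r := fun i => by
    obtain ⟨j, hj, hn⟩ := h (i - 1)
    rw [abs_le] at hj
    obtain ⟨a, ha⟩ := Int.eq_ofNat_of_zero_le (show 0 ≤ 1 - j by omega)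
    have h2 := (hn 0 (q + 3)).2
    simp only [shift_zero, h0, zero_add] at h2
    have h3 := win_add (S := S) a (q + 1) (S.shift (i - 1 + j) e)
    rw [shift_shift, show (a : ℤ) + (i - 1 + j) = i by omega] at h3
    have h4 := win_mono S (show a + (q + 1) ≤ q + 3 by omega) (S.shift (i - 1 + j) e)
    omega
  have h2 := Finset.sum_le_sum fun i (_ : i ∈ Finset.range S.period) => h1 i
  rw [sum_range_win, Finset.sum_const, Finset.card_range, smul_eq_mul] at h2
  have h3 := card_mul_win_period (S := S) hG e
  have h4 : (q + 1) * k ≤ r * Fintype.card E := by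
    apply le_of_mul_le_mul_left (a := S.period) _ period_pos
    calc _ = (q + 1) * (S.period * k) := by ring
      _ = Fintype.card E * ((q + 1) * S.win S.period e) := by rw [← h3]; ring
      _ ≤ Fintype.card E * (S.period * r) := Nat.mul_le_mul_left _ h2
      _ = _ := by ring
  have h5 : r * Fintype.card E < (q + 1) * k := by
    rw [mul_comm (q + 1)]; exact Nat.lt_mul_div_succ _ hk
  omega

omit [Fintype E] in
theorem lag_diam [Fintype V] (hG : G.Connected) (e : E) (z : ℤ) : S.Lag (2 * G.diam + 1) e z := by
  have := hG.nonempty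
  obtain ⟨p, hp⟩ := hG.exists_walk_length_eq_dist (G.src e) (G.src (S.shift z e))
  obtain ⟨j, hj, h⟩ := near_of_walk (S := S) p e (S.shift z e) rfl rfl
  refine ⟨j, by rcases hj with rfl | rfl <;> simp, ?_⟩
  rw [shift_shift, add_comm j, hp] at h
  refine h.mono ?_
  have := SimpleGraph.dist_le_diam (SimpleGraph.connected_iff_ediam_ne_top.1 hG)
    (u := G.src e) (v := G.src (S.shift z e))
  unfold SymDigraph.diam
  omega

end Subcycles

end SymDigraph

/-! ### Trees -/

/-- In an acyclic graph two neighbours of `v` that are joined by a walk avoiding `v` coincide. -/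
theorem SimpleGraph.IsAcyclic.eq_of_walk_avoiding {V : Type*} {T : SimpleGraph V}
    (hT : T.IsAcyclic) {v x y : V} (hx : T.Adj v x) (hy : T.Adj v y) (p : T.Walk x y)
    (hp : v ∉ p.support) : x = y := by
  classical
  have h1 : (SimpleGraph.Walk.cons hx p.bypass).IsPath := by
    rw [SimpleGraph.Walk.cons_isPath_iff]
    exact ⟨p.bypass_isPath, fun h => hp (p.support_bypass_subset_support h)⟩
  have h2 : (SimpleGraph.Walk.cons hy SimpleGraph.Walk.nil).IsPath := by
    simp [SimpleGraph.Walk.cons_isPath_iff, hy.ne]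
  have h3 := (hT.subsingleton_path v y).elim ⟨_, h1⟩ ⟨_, h2⟩
  have h4 := congrArg (fun q : T.Path v y => q.1.getVert 1) h3
  simpa using h4

/-- If every first return of a periodic sequence comes back through the term by which it left, then
every scale `Δ` is met, up to a constant factor, by the distance between two equal terms. If some
first return takes at least `Δ + 2` steps, take a shortest such: the terms equal to the second
term of this excursion cut it into pieces shorter than `Δ + 2`, and grouping pieces gives the
distance. Otherwise all returns are that short, and consecutive ones can be grouped directly. -/
theorem exists_eq_of_first_return {α : Type*} (s : ℕ → α) {M : ℕ} (hM : 0 < M)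
    (hs : ∀ p, s (p + M) = s p)
    (hT : ∀ p g, 0 < g → s (p + g) = s p → (∀ r, p < r → r < p + g → s r ≠ s p) →
      2 ≤ g ∧ s (p + 1) = s (p + g - 1)) (Δ : ℕ) :
    ∃ a d, s (a + d) = s a ∧ Δ ≤ d ∧ d ≤ 2 * Δ + 2 := by
  classical
  rcases Nat.eq_zero_or_pos Δ with rfl | hΔ
  · exact ⟨0, 0, rfl, le_rfl, by omega⟩
  -- a visit late enough, with short returns before it, can be replaced by one at the right scale
  have key : ∀ a c, a + Δ ≤ c → s c = s a →
      (∀ p g, a ≤ p → p + g ≤ c → 0 < g → s (p + g) = s p →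
        (∀ r, p < r → r < p + g → s r ≠ s p) → g < Δ + 2) →
      ∃ a d, s (a + d) = s a ∧ Δ ≤ d ∧ d ≤ 2 * Δ + 2 := by
    intro a c hc hca hgap
    have hex : ∃ r, a + Δ ≤ r ∧ s r = s a := ⟨c, hc, hca⟩
    have hr := Nat.find_spec hex
    have hmin : ∀ r', a + Δ ≤ r' → s r' = s a → Nat.find hex ≤ r' :=
      fun r' h h' => Nat.find_min' hex ⟨h, h'⟩
    generalize Nat.find hex = r at hr hmin
    have hrc := hmin c hc hca
    set p := Nat.findGreatest (fun p => a ≤ p ∧ s p = s a) (a + Δ - 1)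
    have hp : a ≤ p ∧ s p = s a :=
      Nat.findGreatest_spec (P := fun p => a ≤ p ∧ s p = s a) (show a ≤ a + Δ - 1 by omega)
        ⟨le_rfl, rfl⟩
    have hpl : p ≤ a + Δ - 1 := Nat.findGreatest_le _
    have := hgap p (r - p) hp.1 (by omega) (by omega) (by
      rw [show p + (r - p) = r by omega, hr.2, hp.2]) (by
      intro r' h1 h2 h3
      rw [hp.2] at h3
      by_cases h4 : a + Δ ≤ r'
      · have := hmin r' h4 h3
        omega
      · exact Nat.findGreatest_is_greatest (P := fun p => a ≤ p ∧ s p = s a) h1 (by omega)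
          ⟨by omega, h3⟩)
    exact ⟨a, r - a, by rw [show a + (r - a) = r by omega, hr.2], by omega, by omega⟩
  by_cases h : ∃ g, Δ + 2 ≤ g ∧ ∃ p, s (p + g) = s p ∧ ∀ r, p < r → r < p + g → s r ≠ s p
  · obtain ⟨hg, p, hp, hfirst⟩ := Nat.find_spec h
    have hmin := fun g' => Nat.find_min h (m := g')
    generalize Nat.find h = g at hg hp hfirst hmin
    obtain ⟨-, h2⟩ := hT p g (by omega) hp hfirst
    refine key (p + 1) (p + g - 1) (by omega) h2.symm ?_
    intro p' g' h3 h4 h5 h6 h7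
    by_contra h8
    exact hmin g' (by omega) ⟨by omega, p', h6, h7⟩
  · push Not at h
    have hper : ∀ n, s (0 + n * M) = s 0 := fun n => by
      induction n with
      | zero => simp
      | succ n ih => rw [Nat.succ_mul, ← add_assoc, hs, ih]
    refine key 0 (0 + Δ * M) (by nlinarith) (hper Δ) ?_
    intro p g _ _ _ h6 h7
    by_contra h8
    obtain ⟨r, hr1, hr2, hr3⟩ := h g (by omega) p h6
    exact h7 r hr1 hr2 hr3

namespace SymDigraph

namespace Subcycles

variable {V E : Type*} {G : SymDigraph V E} {S : G.Subcycles}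

theorem exists_walk_avoiding (hloop : ∀ e, G.src e ≠ G.tgt e) (e : E) (v : V) (p n : ℕ)
    (h : ∀ r : ℕ, p ≤ r → r ≤ p + n → G.src (S.shift r e) ≠ v) :
    ∃ w : G.toSimple.Walk (G.src (S.shift p e)) (G.src (S.shift (p + n : ℕ) e)),
      v ∉ w.support := by
  induction n with
  | zero => exact ⟨SimpleGraph.Walk.nil, by simpa using (h p le_rfl le_rfl).symm⟩
  | succ n ih =>
    obtain ⟨w, hw⟩ := ih fun r h1 h2 => h r h1 (by omega)
    have hadj : G.toSimple.Adj (G.src (S.shift (p + n : ℕ) e))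
        (G.src (S.shift (p + (n + 1) : ℕ) e)) := by
      have h1 := S.src_shift_add_one (p + n : ℕ) e
      rw [show ((p + n : ℕ) : ℤ) + 1 = (p + (n + 1) : ℕ) by push_cast; ring] at h1
      rw [h1]
      exact ⟨hloop _, _, rfl, rfl⟩
    refine ⟨w.concat hadj, ?_⟩
    rw [SimpleGraph.Walk.support_concat]
    simp only [List.mem_append, List.mem_singleton, not_or]
    exact ⟨hw, (h _ (by omega) le_rfl).symm⟩

variable [Fintype E]

/-- A tree has a delay of cost `1` just above the scale `m / k`. -/
theorem one_le_win_of_isTree (hT : G.IsTree) (hk : 1 ≤ ∑ f, S.w f) (e : E) :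
    1 ≤ S.win (2 * (Fintype.card E / (∑ f, S.w f) + 1) + 2) e := by
  set k := ∑ f, S.w f with hk_def
  set m := Fintype.card E with hm_def
  have hacyc := hT.2.2.isAcyclic
  have hadj : ∀ r : ℕ, G.toSimple.Adj (G.src (S.shift r e)) (G.src (S.shift (r + 1 : ℕ) e)) :=
    fun r => by
      have h1 := S.src_shift_add_one (r : ℤ) e
      push_cast
      rw [h1]
      exact ⟨hT.1 _, _, rfl, rfl⟩
  obtain ⟨a, d, had, hd1, hd2⟩ := exists_eq_of_first_return (fun p : ℕ => G.src (S.shift p e))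
    (period_pos (S := S)) (fun p => by
      push_cast
      rw [← shift_shift, shift_period])
    (by
      intro p g hg h1 h2
      have hg1 : g ≠ 1 := by
        rintro rfl
        exact (hadj p).ne h1.symm
      refine ⟨by omega, ?_⟩
      have hwalk := exists_walk_avoiding (S := S) hT.1 e (G.src (S.shift p e)) (p + 1) (g - 2)
        (fun r h3 h4 => h2 r (by omega) (by omega))
      rw [show p + 1 + (g - 2) = p + g - 1 by omega] at hwalk
      obtain ⟨w, hw⟩ := hwalk
      refine hacyc.eq_of_walk_avoiding (hadj p) ?_ w hw
      have h5 := hadj (p + g - 1)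
      rw [show p + g - 1 + 1 = p + g by omega, h1] at h5
      exact h5.symm)
    (m / k + 1)
  have hnear : S.Near 1 e (S.shift d e) := by
    have h1 := (near_of_src (S := S) had).symm.shift (-a)
    simp only [shift_shift] at h1
    convert h1 using 1
    · simp
    · congr 1; push_cast; ring
  by_contra h0
  have h1 : S.win d e = 0 := by
    have := win_mono S hd2 e
    omega
  have h2 := mul_lt_of_near hT.2.2.1 le_rfl hnear h1
  have h3 : m < k * (m / k + 1) := Nat.lt_mul_div_succ _ hk
  have h4 := Nat.mul_le_mul_right k hd1
  rw [← hk_def, one_mul] at h2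
  rw [mul_comm] at h3
  omega

end Subcycles

end SymDigraph

/-! ### Round-robin counting -/

open Classical in
/-- The number of the first `N` points of the orbit of `p` that are equal to `e`. -/
noncomputable def Equiv.Perm.visits {E : Type*} (π : Equiv.Perm E) (p : E) (N : ℕ) (e : E) : ℕ :=
  ((Finset.range N).filter fun i => (π ^ i) p = e).card

theorem Equiv.Perm.visits_add {E : Type*} (π : Equiv.Perm E) (p : E) (a b : ℕ) (e : E) :
    π.visits p (a + b) e = π.visits p a e + π.visits ((π ^ a) p) b e := by
  classical
  simp only [visits, Finset.card_filter, Finset.sum_range_add]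
  congr 1
  refine Finset.sum_congr rfl fun i _ => ?_
  rw [add_comm a i, pow_add, Equiv.Perm.mul_apply]

/-- Points of one cycle are visited equally often, up to one visit. -/
theorem Equiv.Perm.visits_le_add_one {E : Type*} [Finite E] (π : Equiv.Perm E) {p e f : E}
    (he : π.SameCycle p e) (hf : π.SameCycle p f) (N : ℕ) :
    π.visits p N e ≤ π.visits p N f + 1 := by
  classical
  have hper : p ∈ Function.periodicPts π :=
    ⟨orderOf π, orderOf_pos π, by
      rw [Function.IsPeriodicPt, Function.IsFixedPt, Equiv.Perm.iterate_eq_pow, pow_orderOf_eq_one,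
        Equiv.Perm.one_apply]⟩
  have hd := Function.minimalPeriod_pos_of_mem_periodicPts hper
  set d := Function.minimalPeriod π p with hd_def
  have hcount : ∀ g, π.SameCycle p g → ∃ δ ≤ 1, π.visits p N g = N / d + δ := by
    intro g hg
    obtain ⟨a, -, rfl⟩ := hg.exists_pow_eq'
    have : π.visits p N ((π ^ a) p) = N.count (· ≡ a [MOD d]) := by
      rw [visits, Nat.count_eq_card_filter_range]
      congr 1
      refine Finset.filter_congr fun i _ => ?_
      rw [← Equiv.Perm.iterate_eq_pow, ← Equiv.Perm.iterate_eq_pow,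
        ← Function.iterate_mod_minimalPeriod_eq (n := i),
        ← Function.iterate_mod_minimalPeriod_eq (n := a),
        Function.iterate_eq_iterate_iff_of_lt_minimalPeriod (Nat.mod_lt _ hd) (Nat.mod_lt _ hd)]
      rfl
    rw [this, Nat.count_modEq_card _ hd]
    split_ifs
    exacts [⟨1, le_rfl, rfl⟩, ⟨0, zero_le_one, rfl⟩]
  obtain ⟨δ, h1, h2⟩ := hcount e he
  obtain ⟨δ', h3, h4⟩ := hcount f hf
  omega

namespace SymDigraph

namespace RoundRobin

variable {V E : Type*} [Fintype E] {G : SymDigraph V E} (R : G.RoundRobin) (x : G.State)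

theorem pointer_iterate_add (t Δ : ℕ) (v : V) :
    (R.step^[t + Δ] x).pointer v =
      (R.next ^ (∑ i ∈ Finset.range Δ, (R.step^[t + i] x).tokens v))
        ((R.step^[t] x).pointer v) := by
  induction Δ with
  | zero => simp
  | succ Δ ih =>
    rw [← add_assoc, Function.iterate_succ_apply', Finset.sum_range_succ, add_comm (Finset.sum _ _),
      pow_add, Equiv.Perm.mul_apply, ← ih]
    rfl

theorem cumLoad_eq_visits (t Δ : ℕ) (e : E) :
    R.cumLoad x t Δ e = R.next.visits ((R.step^[t] x).pointer (G.src e))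
      (∑ i ∈ Finset.range Δ, (R.step^[t + i] x).tokens (G.src e)) e := by
  induction Δ with
  | zero => simp [cumLoad, Equiv.Perm.visits]
  | succ Δ ih =>
    rw [cumLoad, Finset.sum_range_succ, ← cumLoad, ih, Finset.sum_range_succ,
      Equiv.Perm.visits_add, ← pointer_iterate_add]
    rfl

theorem cumLoad_le_add_one (t Δ : ℕ) {e f : E} (h : G.src e = G.src f) :
    R.cumLoad x t Δ e ≤ R.cumLoad x t Δ f + 1 := by
  rw [cumLoad_eq_visits, cumLoad_eq_visits, h]
  apply Equiv.Perm.visits_le_add_one <;> rw [R.sameCycle_iff, State.src_pointer]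
  exact h.symm

open Classical in
theorem sum_load_src (v : V) :
    ∑ e ∈ Finset.univ.filter (fun e => G.src e = v), R.load x e = x.tokens v := by
  have h : ∀ i ∈ Finset.range (x.tokens v), (R.next ^ i) (x.pointer v) ∈
      Finset.univ.filter (fun e => G.src e = v) := fun i _ => by
    simp [R.src_next_pow, x.src_pointer]
  have h1 := Finset.card_eq_sum_card_fiberwise h
  rw [Finset.card_range] at h1
  rw [h1]
  refine Finset.sum_congr rfl fun e he => ?_
  rw [Finset.mem_filter] at he
  rw [← he.2]
  rfl

open Classical in
theorem sum_load_src_eq (t : ℕ) (v : V) :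
    ∑ e ∈ Finset.univ.filter (fun e => G.src e = v), R.loadAt x (t + 1) e =
      ∑ e ∈ Finset.univ.filter (fun e => G.tgt e = v), R.loadAt x t e := by
  simp only [loadAt]
  rw [sum_load_src, Function.iterate_succ_apply']
  rfl

open Classical in
theorem sum_cumLoad_src_eq (t Δ : ℕ) (v : V) :
    ∑ e ∈ Finset.univ.filter (fun e => G.src e = v), R.cumLoad x (t + 1) Δ e =
      ∑ e ∈ Finset.univ.filter (fun e => G.tgt e = v), R.cumLoad x t Δ e := by
  simp only [cumLoad]
  rw [Finset.sum_comm, Finset.sum_comm (s := Finset.univ.filter (fun e => G.tgt e = v))]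
  refine Finset.sum_congr rfl fun i _ => ?_
  rw [add_right_comm, sum_load_src_eq]

variable [Fintype V]

theorem sum_load : ∑ e, R.load x e = x.total := by
  classical
  rw [← Finset.sum_fiberwise Finset.univ G.src]
  exact Finset.sum_congr rfl fun v _ => sum_load_src R x v

theorem total_step : (R.step x).total = x.total := by
  classical
  rw [← sum_load R x, ← Finset.sum_fiberwise Finset.univ G.tgt]
  rfl

theorem total_iterate (t : ℕ) : (R.step^[t] x).total = x.total := by
  induction t with
  | zero => rfl
  | succ t ih => rw [Function.iterate_succ_apply', total_step, ih]

/-- There are only finitely many states with a given number of tokens, so that the dynamics is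
eventually periodic. -/
theorem exists_iterate_eq : ∃ T P : ℕ, 0 < P ∧ R.step^[T + P] x = R.step^[T] x := by
  have hle : ∀ t v, (R.step^[t] x).tokens v < x.total + 1 := fun t v => by
    rw [← total_iterate R x t]
    exact Nat.lt_succ_of_le (Finset.single_le_sum (fun _ _ => Nat.zero_le _) (Finset.mem_univ v))
  obtain ⟨a, b, hab, h⟩ := Finite.exists_ne_map_eq_of_infinite
    fun t : ℕ => ((R.step^[t] x).pointer, fun v => (⟨_, hle t v⟩ : Fin (x.total + 1)))
  have heq : R.step^[a] x = R.step^[b] x := by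
    have h1 := congrArg Prod.fst h
    have h2 := congrArg Prod.snd h
    dsimp only at h1 h2
    have h3 : (R.step^[a] x).tokens = (R.step^[b] x).tokens := by
      funext v
      exact congrArg Fin.val (congrFun h2 v)
    generalize R.step^[a] x = y at h1 h3
    generalize R.step^[b] x = z at h1 h3
    cases y; cases z
    cases h1; cases h3
    rfl
  rcases lt_or_gt_of_ne hab with h | h
  · exact ⟨a, b - a, by omega, by rw [Nat.add_sub_cancel' h.le, heq]⟩
  · exact ⟨b, a - b, by omega, by rw [Nat.add_sub_cancel' h.le, heq]⟩

end RoundRobin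

end SymDigraph

/-! ### Balanced loads in the recurrent phase -/

/-- Among the integer families with a given sum and a given size, those taking values in
`{c, c + 1}` have the least sum of squares, and only they. -/
theorem sum_sq_le_of_balanced {ι : Type*} {I O : Finset ι} {b a : ι → ℤ} {c : ℤ}
    (hcard : I.card = O.card) (hsum : ∑ i ∈ I, b i = ∑ j ∈ O, a j)
    (ha : ∀ j ∈ O, a j = c ∨ a j = c + 1) :
    ∑ j ∈ O, a j ^ 2 ≤ ∑ i ∈ I, b i ^ 2 ∧
      (∑ j ∈ O, a j ^ 2 = ∑ i ∈ I, b i ^ 2 → ∀ i ∈ I, b i = c ∨ b i = c + 1) := by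
  have hexp : ∀ (s : Finset ι) (g : ι → ℤ), ∑ i ∈ s, (g i - c) * (g i - c - 1) =
      ∑ i ∈ s, g i ^ 2 - (2 * c + 1) * ∑ i ∈ s, g i + s.card * (c ^ 2 + c) := by
    intro s g
    rw [Finset.mul_sum, ← Finset.sum_sub_distrib, ← nsmul_eq_mul, ← Finset.sum_const,
      ← Finset.sum_add_distrib]
    exact Finset.sum_congr rfl fun i _ => by ring
  have hO : ∑ j ∈ O, (a j - c) * (a j - c - 1) = 0 :=
    Finset.sum_eq_zero fun j hj => by rcases ha j hj with h | h <;> rw [h] <;> ring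
  have hnn : ∀ i ∈ I, 0 ≤ (b i - c) * (b i - c - 1) := fun i _ => by
    rcases le_or_gt (b i) c with h | h
    · nlinarith
    · nlinarith [show c + 1 ≤ b i from h]
  have h1 := hexp I b
  have h2 := hexp O a
  rw [hO] at h2
  rw [hcard, hsum] at h1
  refine ⟨by linarith [Finset.sum_nonneg hnn], fun h i hi => ?_⟩
  have h3 := (Finset.sum_eq_zero_iff_of_nonneg hnn).1 (by linarith) i hi
  rcases mul_eq_zero.1 h3 with h4 | h4
  · left; linarith
  · right; linarith

namespace SymDigraph

variable {V E : Type*} [Fintype E] (G : SymDigraph V E)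

open Classical in
theorem card_filter_tgt (v : V) : (Finset.univ.filter (fun e => G.tgt e = v)).card =
    (Finset.univ.filter (fun e => G.src e = v)).card := by
  refine Finset.card_bij (fun e _ => G.rev e) ?_ ?_ ?_
  · intro e he
    simpa [G.src_rev] using he
  · intro e _ f _ h
    rw [← G.rev_rev e, h, G.rev_rev]
  · intro e he
    exact ⟨G.rev e, by simpa [G.tgt_rev] using he, G.rev_rev e⟩

variable {G} [Fintype V]

namespace RoundRobin

/-- In a periodic phase of the dynamics the loads accumulated by the arcs entering a vertex are as
balanced as those of the arcs leaving it. Indeed, sending the incoming tokens out again balances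
their distribution, which lowers the sum of the squares of the accumulated loads unless it was
balanced before; but this sum is periodic. -/
theorem exists_balanced_of_periodic (R : G.RoundRobin) (x : G.State) {P : ℕ} (hP : 0 < P)
    (hx : ∀ t e, R.loadAt x (t + P) e = R.loadAt x t e) (t Δ : ℕ) (v : V) :
    ∃ c, (∀ e, G.tgt e = v → R.cumLoad x t Δ e = c ∨ R.cumLoad x t Δ e = c + 1) ∧
      ∀ e, G.src e = v → R.cumLoad x (t + 1) Δ e = c ∨ R.cumLoad x (t + 1) Δ e = c + 1 := by
  classical
  have hout : ∀ t v, ∃ c : ℕ, ∀ e, G.src e = v → R.cumLoad x t Δ e = c ∨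
      R.cumLoad x t Δ e = c + 1 := fun t v => by
    rcases (Finset.univ.filter (fun e => G.src e = v)).eq_empty_or_nonempty with h | h
    · refine ⟨0, fun e he => ?_⟩
      have : e ∈ Finset.univ.filter (fun e => G.src e = v) := by simp [he]
      simp [h] at this
    · obtain ⟨f, hf, hmin⟩ := Finset.exists_min_image _ (R.cumLoad x t Δ) h
      refine ⟨R.cumLoad x t Δ f, fun e he => ?_⟩
      have h1 := hmin e (by simp [he])
      simp only [Finset.mem_filter, Finset.mem_univ, true_and] at hf
      have h2 := R.cumLoad_le_add_one x t Δ (he.trans hf.symm)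
      omega
  have hvert : ∀ t v, ∃ c : ℕ, (∀ e, G.src e = v → R.cumLoad x (t + 1) Δ e = c ∨
      R.cumLoad x (t + 1) Δ e = c + 1) ∧
      ∑ e ∈ Finset.univ.filter (fun e => G.src e = v), (R.cumLoad x (t + 1) Δ e : ℤ) ^ 2 ≤
        ∑ e ∈ Finset.univ.filter (fun e => G.tgt e = v), (R.cumLoad x t Δ e : ℤ) ^ 2 ∧
      (∑ e ∈ Finset.univ.filter (fun e => G.src e = v), (R.cumLoad x (t + 1) Δ e : ℤ) ^ 2 =
        ∑ e ∈ Finset.univ.filter (fun e => G.tgt e = v), (R.cumLoad x t Δ e : ℤ) ^ 2 →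
        ∀ e, G.tgt e = v → R.cumLoad x t Δ e = c ∨ R.cumLoad x t Δ e = c + 1) := fun t v => by
    obtain ⟨c, hc⟩ := hout (t + 1) v
    obtain ⟨h1, h2⟩ := sum_sq_le_of_balanced (c := c) (G.card_filter_tgt v)
      (b := fun e => (R.cumLoad x t Δ e : ℤ)) (a := fun e => (R.cumLoad x (t + 1) Δ e : ℤ))
      (by exact_mod_cast (R.sum_cumLoad_src_eq x t Δ v).symm)
      (fun e he => by
        have := hc e (by simpa using he)
        omega)
    refine ⟨c, hc, h1, fun h e he => ?_⟩
    have := h2 h e (by simpa using he)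
    omega
  let Φ : ℕ → ℤ := fun t => ∑ e, (R.cumLoad x t Δ e : ℤ) ^ 2
  have hΦ : ∀ t, Φ (t + 1) = ∑ v, ∑ e ∈ Finset.univ.filter (fun e => G.src e = v),
      (R.cumLoad x (t + 1) Δ e : ℤ) ^ 2 := fun t => (Finset.sum_fiberwise _ _ _).symm
  have hΦ' : ∀ t, Φ t = ∑ v, ∑ e ∈ Finset.univ.filter (fun e => G.tgt e = v),
      (R.cumLoad x t Δ e : ℤ) ^ 2 := fun t => (Finset.sum_fiberwise _ _ _).symm
  have hanti : Antitone Φ := antitone_nat_of_succ_le fun t => by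
    rw [hΦ, hΦ']
    exact Finset.sum_le_sum fun v _ => by
      obtain ⟨c, -, h, -⟩ := hvert t v
      exact h
  have hper : Φ (t + P) = Φ t := by
    refine Finset.sum_congr rfl fun e _ => ?_
    congr 2
    exact Finset.sum_congr rfl fun i _ => by rw [add_right_comm, hx]
  have heq : Φ (t + 1) = Φ t :=
    le_antisymm (hanti (by omega)) (hper.symm.le.trans (hanti (by omega)))
  rw [hΦ, hΦ'] at heq
  have hall := (Finset.sum_eq_sum_iff_of_le fun v _ => by
    obtain ⟨c, -, h, -⟩ := hvert t v
    exact h).1 heq v (Finset.mem_univ v)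
  obtain ⟨c, h1, -, h2⟩ := hvert t v
  exact ⟨c, h2 hall, h1⟩

end RoundRobin

end SymDigraph

/-! ### Matching incoming with outgoing arcs -/

/-- A finite family of sequences that is totally ordered pointwise can be listed in increasing
order. -/
theorem exists_equiv_monotone {α : Type*} [Fintype α] (a : α → ℕ → ℕ) {n : ℕ}
    (hn : Fintype.card α = n)
    (ha : ∀ i j, (∀ x, a i x ≤ a j x) ∨ ∀ x, a j x ≤ a i x) (X : ℕ) :
    ∃ φ : Fin n ≃ α, ∀ i j, i ≤ j → ∀ x ≤ X, a (φ i) x ≤ a (φ j) x := by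
  let ψ : Fin n ≃ α := (Fintype.equivFinOfCardEq hn).symm
  -- on a chain, the pointwise order is recovered from the sums over a horizon
  let key : Fin n → ℕ := fun i => ∑ x ∈ Finset.range (X + 1), a (ψ i) x
  refine ⟨(Tuple.sort key).trans ψ, fun i j hij x hx => ?_⟩
  have hkey : key (Tuple.sort key i) ≤ key (Tuple.sort key j) := Tuple.monotone_sort key hij
  by_contra hlt
  rcases ha (ψ (Tuple.sort key i)) (ψ (Tuple.sort key j)) with h | h
  · exact hlt (h x)
  · refine absurd hkey (not_le.2 (Finset.sum_lt_sum (fun y _ => h y) ⟨x, ?_, not_le.1 hlt⟩))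
    exact Finset.mem_range.2 (by omega)

theorem Fin.eq_of_monotone_of_sum_eq {n : ℕ} {u w : Fin n → ℕ}
    (hu : Monotone u) (hw : Monotone w) (hsum : ∑ i, u i = ∑ i, w i) {c : ℕ}
    (huc : ∀ i, u i = c ∨ u i = c + 1) (hwc : ∀ i, w i = c ∨ w i = c + 1) : u = w := by
  have key : ∀ {u w : Fin n → ℕ}, Monotone u → Monotone w → ∑ i, u i = ∑ i, w i →
      (∀ i, u i = c ∨ u i = c + 1) → (∀ i, w i = c ∨ w i = c + 1) → ∀ i, w i ≤ u i := by
    intro u w hu hw hsum huc hwc i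
    by_contra hlt
    have hi : u i = c ∧ w i = c + 1 := by
      have := huc i
      have := hwc i
      omega
    have : ∑ j, u j < ∑ j, w j := by
      refine Finset.sum_lt_sum (fun j _ => ?_) ⟨i, Finset.mem_univ i, not_le.1 hlt⟩
      have h1 := huc j
      have h2 := hwc j
      rcases le_total j i with h | h
      · have := hu h
        omega
      · have := hw h
        omega
    omega
  funext i
  exact le_antisymm (key hw hu hsum.symm hwc huc i) (key hu hw hsum huc hwc i)

/-- Two finite chains of sequences whose values at each place form the same balanced multiset are
equal up to a bijection of the index sets, on each finite horizon. -/
theorem exists_equiv_of_balanced {α β : Type*} [Fintype α] [Fintype β]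
    (hcard : Fintype.card α = Fintype.card β) (a : α → ℕ → ℕ) (b : β → ℕ → ℕ)
    (ha : ∀ i j, (∀ x, a i x ≤ a j x) ∨ ∀ x, a j x ≤ a i x)
    (hb : ∀ i j, (∀ x, b i x ≤ b j x) ∨ ∀ x, b j x ≤ b i x)
    (hsum : ∀ x, ∑ i, a i x = ∑ j, b j x)
    (hc : ∀ x, ∃ c, (∀ i, a i x = c ∨ a i x = c + 1) ∧ ∀ j, b j x = c ∨ b j x = c + 1) (X : ℕ) :
    ∃ φ : α ≃ β, ∀ i, ∀ x ≤ X, b (φ i) x = a i x := by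
  obtain ⟨φ, hφ⟩ := exists_equiv_monotone a rfl ha X
  obtain ⟨ψ, hψ⟩ := exists_equiv_monotone b hcard.symm hb X
  refine ⟨φ.symm.trans ψ, fun i x hx => ?_⟩
  obtain ⟨c, hac, hbc⟩ := hc x
  have h := Fin.eq_of_monotone_of_sum_eq (u := fun i => a (φ i) x) (w := fun i => b (ψ i) x)
    (fun i j hij => hφ i j hij x hx) (fun i j hij => hψ i j hij x hx)
    (by rw [Equiv.sum_comp φ (fun i => a i x), Equiv.sum_comp ψ (fun i => b i x), hsum])
    (fun i => hac _) (fun i => hbc _)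
  have := congrFun h (φ.symm i)
  simpa using this.symm

namespace SymDigraph

namespace RoundRobin

variable {V E : Type*} [Fintype E] {G : SymDigraph V E} (R : G.RoundRobin) (x : G.State)

theorem cumLoad_add (t a b : ℕ) (e : E) :
    R.cumLoad x t (a + b) e = R.cumLoad x t a e + R.cumLoad x (t + a) b e := by
  simp only [cumLoad, Finset.sum_range_add, add_assoc]

/-- Arcs whose accumulated loads agree up to `1` in every time window are comparable: if the lead
changed, the window between two moments with different leaders would show a difference of `2`. -/
theorem cumLoad_chain (t : ℕ) {e f : E}
    (h : ∀ s Δ, R.cumLoad x (t + s) Δ e ≤ R.cumLoad x (t + s) Δ f + 1 ∧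
      R.cumLoad x (t + s) Δ f ≤ R.cumLoad x (t + s) Δ e + 1) :
    (∀ y, R.cumLoad x t y e ≤ R.cumLoad x t y f) ∨
      ∀ y, R.cumLoad x t y f ≤ R.cumLoad x t y e := by
  by_contra! hcon
  obtain ⟨⟨y, hy⟩, z, hz⟩ := hcon
  rcases le_total y z with hyz | hyz
  · obtain ⟨d, rfl⟩ := Nat.exists_eq_add_of_le hyz
    rw [cumLoad_add, cumLoad_add] at hz
    have := (h y d).2
    omega
  · obtain ⟨d, rfl⟩ := Nat.exists_eq_add_of_le hyz
    rw [cumLoad_add, cumLoad_add] at hy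
    have := (h z d).1
    omega

variable [Fintype V]

/-- In a periodic phase, the arcs can be matched at each vertex in such a way that all tokens
arriving along an arc leave along the arc matched with it. -/
theorem exists_perm_of_periodic {P : ℕ} (hP : 0 < P)
    (hx : ∀ t e, R.loadAt x (t + P) e = R.loadAt x t e) :
    ∃ σ : Equiv.Perm E, (∀ e, G.src (σ e) = G.tgt e) ∧
      ∀ t e, R.loadAt x (t + 1) (σ e) = R.loadAt x t e := by
  classical
  have hbal := R.exists_balanced_of_periodic x hP hx
  have hv : ∀ v, ∃ φ : {e // G.tgt e = v} ≃ {e // G.src e = v}, ∀ e, ∀ y ≤ P,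
      R.cumLoad x 1 y (φ e) = R.cumLoad x 0 y e := fun v => by
    refine exists_equiv_of_balanced ?_
      (fun (e : {e // G.tgt e = v}) y => R.cumLoad x 0 y e)
      (fun (e : {e // G.src e = v}) y => R.cumLoad x 1 y e) ?_ ?_ ?_ ?_ P
    · rw [Fintype.card_subtype, Fintype.card_subtype, card_filter_tgt]
    · refine fun e f => R.cumLoad_chain x 0 fun s Δ => ?_
      obtain ⟨c, hc, -⟩ := hbal (0 + s) Δ v
      have h1 := hc e e.2
      have h2 := hc f f.2
      omega
    · exact fun e f => R.cumLoad_chain x 1 fun s Δ =>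
        ⟨R.cumLoad_le_add_one x _ _ (e.2.trans f.2.symm),
          R.cumLoad_le_add_one x _ _ (f.2.trans e.2.symm)⟩
    · intro y
      have h := R.sum_cumLoad_src_eq x 0 y v
      rw [Finset.sum_subtype _ (p := fun e => G.src e = v) (by simp),
        Finset.sum_subtype _ (p := fun e => G.tgt e = v) (by simp)] at h
      exact h.symm
    · intro y
      obtain ⟨c, hc, hc'⟩ := hbal 0 y v
      exact ⟨c, fun e => hc e e.2, fun e => hc' e e.2⟩
  choose φ hφ using hv
  let σ : Equiv.Perm E := (Equiv.sigmaFiberEquiv G.tgt).symm.trans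
    ((Equiv.sigmaCongrRight φ).trans (Equiv.sigmaFiberEquiv G.src))
  have hσ : ∀ e, σ e = φ (G.tgt e) ⟨e, rfl⟩ := fun e => rfl
  refine ⟨σ, fun e => by rw [hσ]; exact (φ (G.tgt e) ⟨e, rfl⟩).2, ?_⟩
  have hlt : ∀ t < P, ∀ e, R.loadAt x (t + 1) (σ e) = R.loadAt x t e := fun t ht e => by
    have h1 := hφ (G.tgt e) ⟨e, rfl⟩ t ht.le
    have h2 := hφ (G.tgt e) ⟨e, rfl⟩ (t + 1) ht
    rw [cumLoad_add, cumLoad_add, ← hσ] at h2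
    rw [← hσ] at h1
    simp only [cumLoad, Finset.sum_range_one, add_zero, zero_add, add_comm 1 t] at h1 h2
    omega
  have hmod : ∀ n t e, R.loadAt x (t + n * P) e = R.loadAt x t e := fun n t e => by
    induction n with
    | zero => simp
    | succ n ih => rw [Nat.succ_mul, ← add_assoc, hx, ih]
  intro t e
  rw [← Nat.mod_add_div t P, mul_comm P, add_right_comm, hmod, hmod,
    hlt _ (Nat.mod_lt _ hP)]

/-- The recurrent phase of the dynamics consists of tokens travelling along the subcycles of a
subcycle decomposition. -/
theorem exists_subcycles : ∃ (S : G.Subcycles) (T : ℕ), ∑ e, S.w e = x.total ∧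
    ∀ t e, R.loadAt x (T + t) e = S.w (S.shift (-t) e) := by
  obtain ⟨T, P, hP, hper⟩ := R.exists_iterate_eq x
  set y := R.step^[T] x with hy
  have hxy : ∀ t e, R.loadAt x (T + t) e = R.loadAt y t e := fun t e => by
    rw [loadAt, loadAt, hy, ← Function.iterate_add_apply, add_comm]
  have hyP : ∀ t e, R.loadAt y (t + P) e = R.loadAt y t e := fun t e => by
    rw [loadAt, loadAt, Function.iterate_add_apply, hy, ← Function.iterate_add_apply R.step P,
      add_comm P, hper]
  obtain ⟨σ, hσ, hload⟩ := R.exists_perm_of_periodic y hP hyP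
  have hpow : ∀ (t : ℕ) e, R.loadAt y t e = R.loadAt y 0 ((σ ^ (-t : ℤ)) e) := fun t => by
    induction t with
    | zero => simp
    | succ t ih =>
      intro e
      have h1 := hload t (σ⁻¹ e)
      rw [show σ (σ⁻¹ e) = e by simp] at h1
      rw [h1, ih, ← zpow_neg_one, ← Equiv.Perm.mul_apply, ← zpow_add]
      congr 3
      push_cast; ring
  refine ⟨⟨σ, R.loadAt y 0, x.pointer, x.src_pointer, hσ, ?_⟩, T, ?_, fun t e => ?_⟩
  · intro e f hef z Δ
    -- a window of `σ` read backwards is a time window, made to start at a nonnegative time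
    have hM : 0 < orderOf σ := orderOf_pos σ
    obtain ⟨t, ht⟩ : ∃ t : ℕ, (t : ℤ) = (z.natAbs + Δ : ℕ) * orderOf σ - z - Δ + 1 := by
      refine ⟨((z.natAbs + Δ : ℕ) * orderOf σ - z - Δ + 1 : ℤ).toNat, Int.toNat_of_nonneg ?_⟩
      have : ((z.natAbs + Δ : ℕ) : ℤ) ≤ (z.natAbs + Δ : ℕ) * orderOf σ := by
        exact_mod_cast Nat.le_mul_of_pos_right _ hM
      omega
    have hwin : ∀ g, ∑ i ∈ Finset.range Δ, R.loadAt y 0 ((σ ^ (z + i : ℤ)) g) =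
        R.cumLoad y t Δ g := fun g => by
      rw [cumLoad, ← Finset.sum_range_reflect]
      refine Finset.sum_congr rfl fun i hi => ?_
      rw [Finset.mem_range] at hi
      rw [hpow (t + i)]
      congr 1
      have h1 : ((t + (i : ℕ) : ℕ) : ℤ) =
          (z.natAbs + Δ : ℕ) * orderOf σ - (z + (Δ - 1 - i : ℕ)) := by omega
      rw [h1, neg_sub, zpow_sub, mul_comm _ (orderOf σ : ℤ), zpow_mul,
        zpow_natCast σ, pow_orderOf_eq_one, one_zpow, inv_one, mul_one]
    rw [hwin, hwin]
    exact R.cumLoad_le_add_one y t Δ hef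
  · have := R.sum_load y
    rw [hy, total_iterate] at this
    exact this
  · rw [hxy, hpow]
    rfl

omit [Fintype V] in
/-- A time window of an arc is a window of its subcycle read backwards, so it is enough that all
windows of length `D` contain a token. -/
theorem idleness_le_of_win {S : G.Subcycles} {T D : ℕ}
    (hS : ∀ t e, R.loadAt x (T + t) e = S.w (S.shift (-t) e)) (hD : ∀ e, 1 ≤ S.win D e) :
    R.idleness x ≤ D := by
  refine iSup_le fun e => Filter.limsup_le_of_le (by isBoundedDefault) ?_
  filter_upwards [Filter.eventually_ge_atTop T] with t ht
  obtain ⟨s, rfl⟩ := Nat.exists_eq_add_of_le ht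
  refine iInf₂_le D ?_
  have h := hD (S.shift (-(s + D - 1)) e)
  rw [Subcycles.win, ← Finset.sum_range_reflect] at h
  refine h.trans_eq (Finset.sum_congr rfl fun i hi => ?_)
  rw [Finset.mem_range] at hi
  rw [add_assoc, hS, Subcycles.shift_shift]
  congr 2
  omega

end RoundRobin

end SymDigraph

/-! ### Sums of few elements in finite abelian groups -/

section AddChar

variable {A : Type*} [AddCommGroup A] [Finite A]

theorem AddChar.norm_add_sub_one_le (χ : AddChar A ℂ) (a b : A) :
    ‖χ (a + b) - 1‖ ≤ ‖χ a - 1‖ + ‖χ b - 1‖ := by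
  have h : χ (a + b) - 1 = χ a * (χ b - 1) + (χ a - 1) := by
    rw [AddChar.map_add_eq_mul]; ring
  rw [h, add_comm ‖χ a - 1‖]
  refine (norm_add_le _ _).trans ?_
  rw [norm_mul, AddChar.norm_apply, one_mul]

theorem AddChar.norm_neg_sub_one (χ : AddChar A ℂ) (a : A) : ‖χ (-a) - 1‖ = ‖χ a - 1‖ := by
  have h : χ a * (χ (-a) - 1) = -(χ a - 1) := by
    rw [mul_sub, ← AddChar.map_add_eq_mul, add_neg_cancel, AddChar.map_zero_eq_one]; ring
  rw [← norm_neg (χ a - 1), ← h, norm_mul, AddChar.norm_apply, one_mul]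

theorem AddChar.norm_sum_sub_one_le (χ : AddChar A ℂ) (U : Finset A) :
    ‖χ (∑ a ∈ U, a) - 1‖ ≤ ∑ a ∈ U, ‖χ a - 1‖ :=
  Finset.le_sum_of_subadditive (fun a => ‖χ a - 1‖) (by simp) χ.norm_add_sub_one_le U fun a => a

theorem AddChar.add_apply_neg (χ : AddChar A ℂ) (a : A) :
    χ a + χ (-a) = ((2 - ‖χ a - 1‖ ^ 2 : ℝ) : ℂ) := by
  have h1 : χ (-a) = (starRingEnd ℂ) (χ a) := AddChar.map_neg_eq_conj χ a
  have h2 : Complex.normSq (χ a) = 1 := by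
    rw [Complex.normSq_eq_norm_sq, AddChar.norm_apply, one_pow]
  have h3 : ‖χ a - 1‖ ^ 2 = 2 - 2 * (χ a).re := by
    rw [← Complex.normSq_eq_norm_sq, Complex.normSq_sub, h2]
    simp; ring
  rw [h1, Complex.add_conj, h3]
  push_cast; ring

omit [Finite A] in
theorem AddChar.map_finset_sum {ι : Type*} (χ : AddChar A ℂ) (U : Finset ι) (f : ι → A) :
    χ (∑ i ∈ U, f i) = ∏ i ∈ U, χ (f i) := by
  classical
  induction U using Finset.induction_on with
  | empty => simp
  | insert a U ha ih => rw [Finset.sum_insert ha, Finset.prod_insert ha, χ.map_add_eq_mul, ih]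

/-- A maximal subset of `S` with distinct subset sums has at most `log₂ |A|` elements, and it
detects all characters that are detected by `S`. -/
theorem exists_small_subset (S : Set A) : ∃ T : Finset A, ↑T ⊆ S ∧ 2 ^ T.card ≤ Nat.card A ∧
    ∀ χ : AddChar A ℂ, ∀ d ∈ S, ‖χ d - 1‖ ≤ 2 * ∑ t ∈ T, ‖χ t - 1‖ := by
  classical
  have := Fintype.ofFinite A
  let P : Finset A → Prop := fun T => ↑T ⊆ S ∧
    Set.InjOn (fun U : Finset A => ∑ a ∈ U, a) (T.powerset : Set (Finset A))
  have hne : (Finset.univ.filter P).Nonempty := ⟨∅, by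
    simp only [P, Finset.mem_filter, Finset.mem_univ, true_and, Finset.coe_empty,
      Set.empty_subset, Finset.powerset_empty, Finset.coe_singleton, Set.injOn_singleton]⟩
  obtain ⟨T, hT, hmax⟩ := Finset.exists_max_image (Finset.univ.filter P) Finset.card hne
  obtain ⟨hTS, hinj⟩ : P T := by simpa using hT
  refine ⟨T, hTS, ?_, fun χ d hd => ?_⟩
  · rw [← Finset.card_powerset, Nat.card_eq_fintype_card, ← Finset.card_univ]
    exact Finset.card_le_card_of_injOn _ (fun _ _ => Finset.mem_univ _) hinj
  have hnn : ∀ t ∈ T, 0 ≤ ‖χ t - 1‖ := fun _ _ => norm_nonneg _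
  have hsub : ∀ U ⊆ T, ‖χ (∑ a ∈ U, a) - 1‖ ≤ ∑ t ∈ T, ‖χ t - 1‖ := fun U hU =>
    (χ.norm_sum_sub_one_le U).trans (Finset.sum_le_sum_of_subset_of_nonneg hU fun t ht _ => hnn t ht)
  by_cases hdT : d ∈ T
  · have h1 := Finset.single_le_sum hnn hdT
    have h2 := Finset.sum_nonneg hnn
    linarith
  -- by maximality `d` is a difference of two subset sums of `T`
  have hnot : ¬ P (insert d T) := fun h => by
    have := hmax (insert d T) (by simpa using h)
    rw [Finset.card_insert_of_notMem hdT] at this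
    omega
  have key : ∀ U U' : Finset A, U ⊆ insert d T → U' ⊆ insert d T → d ∈ U → d ∉ U' →
      ∑ a ∈ U, a = ∑ a ∈ U', a → ‖χ d - 1‖ ≤ 2 * ∑ t ∈ T, ‖χ t - 1‖ := by
    intro U U' hU hU' hdU hdU' h
    have hd : d = ∑ a ∈ U', a + -∑ a ∈ U.erase d, a := by
      rw [← h, ← Finset.add_sum_erase U (fun a => a) hdU]; abel
    have h1 := hsub U' ((Finset.subset_insert_iff_of_notMem hdU').1 hU')
    have h2 := hsub (U.erase d) (by
      rw [← Finset.subset_insert_iff]; exact hU)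
    have h3 := χ.norm_add_sub_one_le (∑ a ∈ U', a) (-∑ a ∈ U.erase d, a)
    rw [← hd, AddChar.norm_neg_sub_one] at h3
    linarith
  by_contra hcon
  refine hnot ⟨?_, ?_⟩
  · rw [Finset.coe_insert]
    exact Set.insert_subset hd hTS
  intro U hU U' hU' h
  rw [Finset.mem_coe, Finset.mem_powerset] at hU hU'
  dsimp only at h
  by_cases h1 : d ∈ U <;> by_cases h2 : d ∈ U'
  · have h3 : U.erase d = U'.erase d := by
      apply hinj
      · exact Finset.mem_coe.2 (Finset.mem_powerset.2 (Finset.subset_insert_iff.1 hU))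
      · exact Finset.mem_coe.2 (Finset.mem_powerset.2 (Finset.subset_insert_iff.1 hU'))
      · rw [← Finset.add_sum_erase U (fun a => a) h1, ← Finset.add_sum_erase U' (fun a => a) h2] at h
        exact add_left_cancel h
    rw [← Finset.insert_erase h1, h3, Finset.insert_erase h2]
  · exact absurd (key U U' hU hU' h1 h2 h) hcon
  · exact absurd (key U' U hU' hU h2 h1 h.symm) hcon
  · apply hinj _ _ h
    · simpa using (Finset.subset_insert_iff_of_notMem h1).1 hU
    · simpa using (Finset.subset_insert_iff_of_notMem h2).1 hU'

end AddChar

/-- If no nontrivial character is close to `1` on all of `S`, then every element of the finite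
abelian group is a sum of polylogarithmically many elements of `S ∪ -S ∪ {0}`. The number of
representations by elements of `T ∪ -T ∪ {0}`, for a small detecting subset `T` of `S`, is computed
by orthogonality of characters; the trivial character dominates. -/
theorem exists_sum_eq_of_addChar {A : Type*} [AddCommGroup A] [Finite A] {S : Set A}
    (hS : ∀ χ : AddChar A ℂ, χ ≠ 0 → ∃ d ∈ S, 1 / 2 ≤ ‖χ d - 1‖) {R s : ℕ}
    (hA : Nat.card A < 2 ^ (R + 1))
    (hs : 16 * R * (2 * R + 1) * Real.log (Nat.card A) ≤ s) (x : A) :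
    ∃ g : Fin s → A, (∀ j, g j = 0 ∨ g j ∈ S ∨ -g j ∈ S) ∧ ∑ j, g j = x := by
  classical
  have := Fintype.ofFinite A
  rw [Nat.card_eq_fintype_card] at hA hs
  obtain ⟨T, hTS, hcard, hT⟩ := exists_small_subset S
  rw [Nat.card_eq_fintype_card] at hcard
  set r := T.card with hr
  have hrR : r ≤ R := by
    by_contra h
    exact absurd (hcard.trans_lt hA) (not_lt.2 (Nat.pow_le_pow_right (by norm_num) (by omega)))
  let v : Option (T ⊕ T) → A := fun o => o.elim 0 (Sum.elim (fun t => t) fun t => -t)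
  have hv : ∀ o, v o = 0 ∨ v o ∈ S ∨ -v o ∈ S := by
    rintro (_ | t | t)
    · exact Or.inl rfl
    · exact Or.inr (Or.inl (hTS t.2))
    · exact Or.inr (Or.inr (by simpa [v] using hTS t.2))
  by_contra hcon
  push Not at hcon
  have hno : ∀ p : Fin s → Option (T ⊕ T), ∑ j, v (p j) ≠ x := fun p => hcon _ fun j => hv (p j)
  let μ : AddChar A ℂ → ℂ := fun χ => ∑ o, χ (v o)
  have hμ : ∀ χ, μ χ = ((2 * r + 1 - ∑ t ∈ T, ‖χ t - 1‖ ^ 2 : ℝ) : ℂ) := fun χ => by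
    have h1 : μ χ = 1 + ∑ t ∈ T, (χ t + χ (-t)) := by
      simp only [μ, Fintype.sum_option, Fintype.sum_sum_type, v, Option.elim, Sum.elim_inl,
        Sum.elim_inr, AddChar.map_zero_eq_one, Finset.sum_add_distrib]
      rw [Finset.sum_coe_sort T fun t => χ t, Finset.sum_coe_sort T fun t => χ (-t)]
    rw [h1, Finset.sum_congr rfl fun t _ => χ.add_apply_neg t, ← Complex.ofReal_sum,
      Finset.sum_sub_distrib, Finset.sum_const]
    push_cast
    rw [nsmul_eq_mul]; ring
  have hzero : ∑ χ : AddChar A ℂ, χ (-x) * μ χ ^ s = 0 := by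
    have h1 : ∀ χ : AddChar A ℂ, χ (-x) * μ χ ^ s =
        ∑ p : Fin s → Option (T ⊕ T), χ (∑ j, v (p j) - x) := fun χ => by
      rw [show μ χ = ∑ o, χ (v o) from rfl, Fintype.sum_pow, Finset.mul_sum]
      refine Finset.sum_congr rfl fun p _ => ?_
      rw [sub_eq_neg_add, AddChar.map_add_eq_mul, AddChar.map_finset_sum]
    simp only [h1]
    rw [Finset.sum_comm]
    refine Finset.sum_eq_zero fun p _ => ?_
    rw [AddChar.sum_apply_eq_ite, if_neg (sub_ne_zero.2 (hno p))]
  set B : ℝ := 2 * r + 1 with hB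
  have hBpos : 0 < B := by positivity
  set y : ℝ := 1 / (16 * R * (2 * R + 1)) with hy
  have hsmall : ∀ χ : AddChar A ℂ, χ ≠ 0 → ‖μ χ‖ ≤ B * (1 - y) ∧ 1 ≤ R := by
    intro χ hχ
    obtain ⟨d, hd, hd'⟩ := hS χ hχ
    have h1 : 1 / 4 ≤ ∑ t ∈ T, ‖χ t - 1‖ := by linarith [hT χ d hd]
    have hr1 : 1 ≤ r := by
      by_contra h
      have : T = ∅ := Finset.card_eq_zero.1 (by omega)
      rw [this] at h1
      norm_num at h1
    have hr1' : (1 : ℝ) ≤ r := by exact_mod_cast hr1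
    have hrR' : (r : ℝ) ≤ R := by exact_mod_cast hrR
    have h2 : (∑ t ∈ T, ‖χ t - 1‖) ^ 2 ≤ r * ∑ t ∈ T, ‖χ t - 1‖ ^ 2 :=
      sq_sum_le_card_mul_sum_sq
    have h3 : 1 / 16 ≤ r * ∑ t ∈ T, ‖χ t - 1‖ ^ 2 := by nlinarith
    have h4 : ∑ t ∈ T, ‖χ t - 1‖ ^ 2 ≤ 4 * r := by
      have : ∀ t ∈ T, ‖χ t - 1‖ ^ 2 ≤ 4 := fun t _ => by
        have h5 : ‖χ t - 1‖ ≤ 2 := by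
          refine (norm_sub_le _ _).trans ?_
          rw [AddChar.norm_apply, norm_one]; norm_num
        nlinarith [norm_nonneg (χ t - 1)]
      refine (Finset.sum_le_sum this).trans ?_
      rw [Finset.sum_const, nsmul_eq_mul, mul_comm]
    have hRpos : (0 : ℝ) < R := by linarith
    have hBy : B * y ≤ 1 / (16 * r) := by
      rw [hy, mul_one_div, div_le_div_iff₀ (by positivity) (by positivity)]
      rw [hB]
      nlinarith
    have h6 : 1 / (16 * (r : ℝ)) ≤ ∑ t ∈ T, ‖χ t - 1‖ ^ 2 := by
      rw [div_le_iff₀ (by positivity)]; linarith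
    have h7 : 1 / (16 * (r : ℝ)) ≤ 1 := by
      rw [div_le_one (by positivity)]; linarith
    refine ⟨?_, hr1.trans hrR⟩
    rw [hμ, Complex.norm_real, Real.norm_eq_abs, abs_le]
    constructor <;> rw [mul_sub, mul_one] <;> linarith
  -- the trivial character is outweighed by the others
  have hmain : B ^ s ≤ ((Fintype.card A : ℝ) - 1) * (B * (1 - y)) ^ s := by
    have h1 := Finset.add_sum_erase Finset.univ (fun χ : AddChar A ℂ => χ (-x) * μ χ ^ s)
      (Finset.mem_univ 0)
    rw [hzero] at h1
    have h2 : μ 0 = (B : ℂ) := by rw [hμ]; simp [hB]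
    rw [AddChar.zero_apply, one_mul, h2] at h1
    have h3 : (B : ℂ) ^ s = -∑ χ ∈ Finset.univ.erase (0 : AddChar A ℂ), χ (-x) * μ χ ^ s :=
      eq_neg_of_add_eq_zero_left h1
    have h4 : B ^ s = ‖(B : ℂ) ^ s‖ := by
      rw [norm_pow, Complex.norm_real, Real.norm_of_nonneg hBpos.le]
    rw [h4, h3, norm_neg]
    have h5 : ∀ χ ∈ Finset.univ.erase (0 : AddChar A ℂ),
        ‖χ (-x) * μ χ ^ s‖ ≤ (B * (1 - y)) ^ s := fun χ hχ => by
      rw [norm_mul, AddChar.norm_apply, one_mul, norm_pow]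
      exact pow_le_pow_left₀ (norm_nonneg _) (hsmall χ (Finset.ne_of_mem_erase hχ)).1 s
    refine (norm_sum_le_of_le _ h5).trans ?_
    rw [Finset.sum_const, Finset.card_erase_of_mem (Finset.mem_univ _), Finset.card_univ,
      AddChar.card_eq, nsmul_eq_mul, Nat.cast_sub Fintype.card_pos, Nat.cast_one]
  have hApos : (0 : ℝ) < Fintype.card A := by exact_mod_cast Fintype.card_pos
  rw [mul_pow, mul_left_comm] at hmain
  have h1 : 1 ≤ ((Fintype.card A : ℝ) - 1) * (1 - y) ^ s := by
    by_contra h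
    nlinarith [pow_pos hBpos s]
  rcases Nat.lt_or_ge 1 (Fintype.card A) with hA1 | hA1
  · obtain ⟨χ, hχ⟩ : ∃ χ : AddChar A ℂ, χ ≠ 0 := by
      have : Nontrivial (AddChar A ℂ) := by
        rw [← Fintype.one_lt_card_iff_nontrivial, AddChar.card_eq]; exact hA1
      exact exists_ne 0
    have hR1 : (1 : ℝ) ≤ R := by exact_mod_cast (hsmall χ hχ).2
    have hy1 : y ≤ 1 := by
      rw [hy, div_le_one (by positivity)]; nlinarith
    have h2 : (1 - y) ^ s ≤ Real.exp (-(y * s)) := by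
      rw [show -(y * s) = (s : ℝ) * -y by ring, Real.exp_nat_mul]
      exact pow_le_pow_left₀ (by linarith) (by linarith [Real.add_one_le_exp (-y)]) s
    have h3 : Real.log (Fintype.card A) ≤ y * s := by
      rw [hy, one_div_mul_eq_div, le_div_iff₀ (by positivity)]
      linarith
    have h4 : Real.exp (-(y * s)) ≤ (Fintype.card A : ℝ)⁻¹ := by
      rw [Real.exp_neg]
      apply inv_anti₀ hApos
      rwa [← Real.log_le_iff_le_exp hApos]
    have h5 : ((Fintype.card A : ℝ) - 1) * (1 - y) ^ s ≤
        ((Fintype.card A : ℝ) - 1) * (Fintype.card A : ℝ)⁻¹ :=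
      mul_le_mul_of_nonneg_left (h2.trans h4) (by
        have : (1 : ℝ) ≤ Fintype.card A := by exact_mod_cast hA1.le
        linarith)
    rw [sub_one_mul _ (Fintype.card A : ℝ)⁻¹, mul_inv_cancel₀ hApos.ne'] at h5
    have := inv_pos.2 hApos
    linarith
  · have : (Fintype.card A : ℝ) - 1 = 0 := by
      have : Fintype.card A = 1 := le_antisymm hA1 Fintype.card_pos
      rw [this]; norm_num
    rw [this, zero_mul] at h1
    linarith

/-! ### Winding numbers and the delays of one subcycle -/

namespace SymDigraph

namespace Subcycles

variable {V E : Type*} {G : SymDigraph V E} {S : G.Subcycles}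

theorem Lag.mono {r s : ℕ} {e : E} {z : ℤ} (h : S.Lag r e z) (hrs : r ≤ s) : S.Lag s e z := by
  obtain ⟨j, hj, h⟩ := h
  exact ⟨j, hj, h.mono hrs⟩

theorem lag_zero (e : E) : S.Lag 0 e 0 := ⟨0, by simp, by simpa using Near.refl e⟩

theorem Lag.neg {r : ℕ} {e : E} {z : ℤ} (h : S.Lag r e z) : S.Lag r e (-z) := by
  obtain ⟨j, hj, h⟩ := h
  refine ⟨-j, by rwa [abs_neg], ?_⟩
  have h1 := h.symm.shift (-(z + j))
  rwa [shift_shift, neg_add_cancel, shift_zero, neg_add] at h1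

theorem Lag.add {r s : ℕ} {e : E} {a b : ℤ} (ha : S.Lag r e a) (hb : S.Lag s e b) :
    S.Lag (r + s + 2) e (a + b) := by
  obtain ⟨i, hi, ha⟩ := ha
  obtain ⟨j, hj, hb⟩ := hb
  rw [abs_le] at hi hj
  have h := ha.trans (hb.shift (a + i))
  rw [shift_shift, show a + i + (b + j) = a + b + (i + j) by ring] at h
  by_cases h1 : |i + j| ≤ 1
  · exact ⟨i + j, h1, h.mono (by omega)⟩
  -- a time error of two units can be undone at cost `2`
  rcases (show i + j = 2 ∨ i + j = -2 by
    rw [abs_le] at h1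
    omega) with h2 | h2
  · refine ⟨0, by simp, ?_⟩
    have h3 := (near_shift_two (S := S) (S.shift (a + b) e)).symm
    rw [shift_shift, add_comm 2] at h3
    rw [h2] at h
    simpa using h.trans h3
  · refine ⟨0, by simp, ?_⟩
    have h3 := near_shift_two (S := S) (S.shift (a + b + -2) e)
    rw [shift_shift, show 2 + (a + b + -2) = a + b by ring] at h3
    rw [h2] at h
    simpa using h.trans h3

theorem lag_sum {r : ℕ} {e : E} {s : ℕ} (g : Fin s → ℤ) (h : ∀ j, S.Lag r e (g j)) :
    S.Lag (s * (r + 2)) e (∑ j, g j) := by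
  induction s with
  | zero => simpa using lag_zero e
  | succ s ih =>
    rw [Fin.sum_univ_castSucc]
    refine ((ih _ fun j => h j.castSucc).add (h (Fin.last s))).mono ?_
    rw [Nat.succ_mul]
    omega

variable (S) in
/-- Some arc of the subcycle of `f` is at discrepancy at most `h` from `e`. -/
def Reach (h : ℕ) (e f : E) : Prop := ∃ z : ℤ, S.Near h e (S.shift z f)

theorem Reach.near_shift {h r : ℕ} {e f : E} (hr : S.Reach h e f) {a : ℤ}
    (hf : S.Near r f (S.shift a f)) : S.Near (2 * h + r) e (S.shift a e) := by
  obtain ⟨z, hz⟩ := hr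
  have h1 := hf.shift z
  have h2 := hz.symm.shift a
  rw [shift_shift, add_comm z a, ← shift_shift] at h1
  exact ((hz.trans h1).trans h2).mono (by omega)

theorem Reach.lag {h r : ℕ} {e f : E} (hr : S.Reach h e f) {a : ℤ} (hf : S.Lag r f a) :
    S.Lag (2 * h + r) e a := by
  obtain ⟨j, hj, hn⟩ := hf
  exact ⟨j, hj, hr.near_shift hn⟩

theorem _root_.Complex.abs_arg_lt_of_norm_sub_one {z : ℂ} (hz : ‖z‖ = 1) (h : ‖z - 1‖ < 1 / 2) :
    |z.arg| < Real.pi / 4 := by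
  have hz0 : z ≠ 0 := by
    rintro rfl
    simp at hz
  have h1 := Complex.angle_le_mul_norm_sub hz norm_one
  rw [Complex.angle_one_right hz0] at h1
  nlinarith [Real.pi_pos]

/-- A root of unity all of whose powers are close to `1` is `1`, as the sum of the powers of any
other one vanishes. -/
theorem _root_.Complex.eq_one_of_pow_near_one {u : ℂ} {l : ℕ} (hl : 0 < l) (hu : u ^ l = 1)
    (h : ∀ j : ℕ, ‖u ^ j - 1‖ < 1 / 2) : u = 1 := by
  by_contra hne
  have h1 : ∑ j ∈ Finset.range l, u ^ j = 0 := by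
    rw [geom_sum_eq hne, hu, sub_self, zero_div]
  have h2 : ∀ j ∈ Finset.range l, 0 < (u ^ j).re := fun j _ => by
    have h3 := (Complex.abs_re_le_norm (u ^ j - 1)).trans_lt (h j)
    rw [Complex.sub_re, Complex.one_re, abs_lt] at h3
    linarith
  have h3 := Finset.sum_pos h2 ⟨0, Finset.mem_range.2 hl⟩
  rw [← Complex.re_sum, h1, Complex.zero_re] at h3
  exact lt_irrefl _ h3

variable [Fintype E]

/-- If a character is close to `1` on all cheap delays of `e`, it assigns to each vertex a point of
the unit circle, up to a small error, such that each arc `a` moves by about `χ (-1)`. Let `θ a` be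
the small angle by which `a` moves. Opposite arcs move by opposite angles, so that the sum of all
`θ a` is `0`. On the other hand, along a subcycle the errors telescope, so that the same sum is
`|E|` times the angle of `χ (-1)`. Hence `χ (-1) = 1`. -/
theorem addChar_eq_zero_of_lag {h l : ℕ} [NeZero l] {e : E}
    (hreach : ∀ f, S.Reach h e f) (χ : AddChar (ZMod l) ℂ)
    (hχ : ∀ z : ℤ, S.Lag (2 * h + 1) e z → ‖χ (z : ZMod l) - 1‖ < 1 / 2) : χ = 0 := by
  let X : ℤ → ℂ := fun z => χ (z : ZMod l)
  have hadd : ∀ a b, X (a + b) = X a * X b := fun a b => by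
    simp only [X, Int.cast_add, AddChar.map_add_eq_mul]
  have hnorm : ∀ a, ‖X a‖ = 1 := fun a => χ.norm_apply _
  have hne : ∀ a, X a ≠ 0 := fun a ha => by
    have := hnorm a
    rw [ha, norm_zero] at this
    exact zero_ne_one this
  have hneg : ∀ a, X (-a) = (X a)⁻¹ := fun a => by
    simp only [X, Int.cast_neg, AddChar.map_neg_eq_inv]
  have hpow : ∀ (a : ℤ) (j : ℕ), X (j * a) = X a ^ j := fun a j => by
    change χ ((j * a : ℤ) : ZMod l) = χ a ^ j
    rw [Int.cast_mul, Int.cast_natCast, ← nsmul_eq_mul, AddChar.map_nsmul_eq_pow]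
  -- the lengths of all closed subcycle walks are in the kernel of the character
  have hclosed : ∀ (f : E) (a : ℤ), S.shift a f = f → X a = 1 := by
    intro f a ha
    have hj : ∀ j : ℕ, S.shift (j * a) f = f := fun j => by
      induction j with
      | zero => simp
      | succ j ih =>
        rw [show ((j + 1 : ℕ) : ℤ) * a = a + j * a by push_cast; ring, ← shift_shift, ih, ha]
    refine Complex.eq_one_of_pow_near_one (l := l) (Nat.pos_of_ne_zero (NeZero.ne l)) ?_ fun j => ?_
    · rw [← hpow]
      simp [X]
    · rw [← hpow]
      refine hχ _ ⟨0, by simp, ?_⟩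
      have h1 : S.Near 0 f (S.shift (j * a) f) := by
        rw [hj]
        exact Near.refl f
      simpa using ((hreach f).near_shift h1).mono (by omega)
  obtain ⟨z, hz, hzσ⟩ : ∃ z : E → ℤ, (∀ f, S.Near h e (S.shift (z f) f)) ∧
      ∀ f, X (z (S.σ f)) = X (z f) * X (-1) := by
    choose z₀ hz₀ using hreach
    let rep : E → E := fun f => (Quotient.mk (Equiv.Perm.SameCycle.setoid S.σ) f).out
    have hrep : ∀ f, ∃ i : ℤ, S.shift i (rep f) = f := fun f =>
      Quotient.exact (Quotient.out_eq (Quotient.mk (Equiv.Perm.SameCycle.setoid S.σ) f))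
    have hrepσ : ∀ f, rep (S.σ f) = rep f := fun f => by
      have : Quotient.mk (Equiv.Perm.SameCycle.setoid S.σ) (S.σ f) =
          Quotient.mk (Equiv.Perm.SameCycle.setoid S.σ) f :=
        Quotient.sound (Equiv.Perm.sameCycle_apply_left.2 (Equiv.Perm.SameCycle.refl _ _))
      simp only [rep, this]
    choose i hi using hrep
    have hi' : ∀ f, S.shift (-i f) f = rep f := fun f => by
      have h1 := congrArg (S.shift (-i f)) (hi f)
      rw [shift_shift, neg_add_cancel, shift_zero] at h1
      exact h1.symm
    refine ⟨fun f => z₀ (rep f) - i f, fun f => ?_, fun f => ?_⟩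
    · have h1 := hz₀ (rep f)
      have h2 : S.shift (z₀ (rep f) - i f) f = S.shift (z₀ (rep f)) (rep f) := by
        rw [sub_eq_add_neg, ← shift_shift, hi']
      rwa [h2]
    · have h1 : S.shift (i (S.σ f) - i f - 1) (rep f) = rep f := by
        have h2 := hi (S.σ f)
        rw [hrepσ] at h2
        rw [show i (S.σ f) - i f - 1 = (-i f - 1) + i (S.σ f) by ring, ← shift_shift, h2,
          ← shift_one, shift_shift, sub_add_cancel, hi']
      have h2 := hclosed _ _ h1
      have h3 : z₀ (rep f) - i f + -1 = (i (S.σ f) - i f - 1) + (z₀ (rep f) - i (S.σ f)) := by ring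
      dsimp only
      rw [← hadd, h3, hadd, h2, one_mul, hrepσ]
  have hsrc : ∀ f f', G.src f = G.src f' → ‖X (z f - z f') - 1‖ < 1 / 2 := by
    intro f f' hff
    refine hχ _ ⟨0, by simp, ?_⟩
    have h1 := (hz f).trans ((near_of_src hff).shift (z f))
    have h2 := (hz f').symm.shift (z f - z f')
    rw [shift_shift, sub_add_cancel] at h2
    simpa using (h1.trans h2).mono (by omega)
  let α : ℤ → ℝ := fun a => (X a).arg
  have hα : ∀ a, ‖X a - 1‖ < 1 / 2 → |α a| < Real.pi / 4 := fun a =>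
    Complex.abs_arg_lt_of_norm_sub_one (hnorm a)
  have hαneg : ∀ a, α a ≠ Real.pi → α (-a) = -α a := fun a ha => by
    simp only [α, hneg, Complex.arg_inv]
    exact if_neg ha
  have hαadd : ∀ a b, |α a| + |α b| < Real.pi → α (a + b) = α a + α b := fun a b hab => by
    simp only [α, hadd]
    refine Complex.arg_mul (hne a) (hne b) ?_
    have h1 := (abs_add_le (α a) (α b)).trans_lt hab
    rw [abs_lt] at h1
    exact ⟨h1.1, h1.2.le⟩
  have hpi := Real.pi_pos
  have hone : |α (-1)| < Real.pi / 4 := by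
    refine hα _ (hχ _ ⟨1, by simp, ?_⟩)
    simpa using (Near.refl (S := S) e).mono (Nat.zero_le _)
  let c : V → ℤ := fun v => z (S.out v)
  let β : E → ℝ := fun f => α (z f - c (G.src f))
  have hβ : ∀ f, |β f| < Real.pi / 4 := fun f => hα _ (hsrc _ _ (S.src_out _).symm)
  let θ : E → ℝ := fun f => α (c (G.tgt f) - c (G.src f))
  have hθ : ∀ f, θ f = β f - β (S.σ f) + α (-1) := by
    intro f
    have h1 : α (-(z (S.σ f) - c (G.tgt f))) = -β (S.σ f) := by
      have h2 := hβ (S.σ f)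
      simp only [β, S.src_σ] at h2 ⊢
      refine hαneg _ fun h3 => ?_
      rw [h3, abs_of_pos hpi] at h2
      linarith
    have h2 : θ f = α ((z f - c (G.src f)) + -(z (S.σ f) - c (G.tgt f)) + -1) := by
      have h3 : X (z (S.σ f) - z f) = X (-1) := by
        rw [sub_eq_add_neg, hadd, hzσ, hneg (z f), mul_right_comm, mul_inv_cancel₀ (hne _),
          one_mul]
      simp only [θ, α]
      congr 1
      rw [hadd, ← h3, ← hadd]
      congr 1
      ring
    have h4 := hβ f
    have h5 := hβ (S.σ f)
    have h6 : α ((z f - c (G.src f)) + -(z (S.σ f) - c (G.tgt f))) = β f - β (S.σ f) := by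
      rw [hαadd, h1]
      · rfl
      · rw [h1, abs_neg]
        change |β f| + _ < _
        linarith
    rw [h2, hαadd, h6]
    rw [h6]
    have h7 := abs_sub (β f) (β (S.σ f))
    linarith
  have hθrev : ∀ f, θ (G.rev f) = -θ f := fun f => by
    have h1 : |θ f| < Real.pi := by
      rw [hθ, abs_lt]
      have h4 := abs_lt.1 (hβ f)
      have h5 := abs_lt.1 (hβ (S.σ f))
      have h6 := abs_lt.1 hone
      constructor <;> linarith
    simp only [θ, G.src_rev, G.tgt_rev] at h1 ⊢
    rw [← hαneg, neg_sub]
    intro h2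
    rw [h2, abs_of_pos hpi] at h1
    exact lt_irrefl _ h1
  have hsum : ∑ f, θ f = 0 := by
    have h1 : ∑ f, θ (G.rev f) = ∑ f, θ f :=
      Equiv.sum_comp (⟨G.rev, G.rev, G.rev_rev, G.rev_rev⟩ : E ≃ E) θ
    simp only [hθrev, Finset.sum_neg_distrib] at h1
    linarith
  have hsum' : ∑ f, θ f = Fintype.card E * α (-1) := by
    simp only [hθ, Finset.sum_add_distrib, Finset.sum_sub_distrib]
    rw [Equiv.sum_comp S.σ β, sub_self, zero_add, Finset.sum_const, nsmul_eq_mul, Finset.card_univ]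
  have hm : (Fintype.card E : ℝ) ≠ 0 := by
    exact_mod_cast (Fintype.card_pos_iff.2 ⟨e⟩).ne'
  have hα1 : α (-1) = 0 := by
    rw [hsum] at hsum'
    exact (mul_eq_zero.1 hsum'.symm).resolve_left hm
  have hX1 : X 1 = 1 := by
    have h1 : X (-1) = 1 := by
      have h2 := Complex.norm_mul_exp_arg_mul_I (X (-1))
      rw [show (X (-1)).arg = 0 from hα1, hnorm] at h2
      simpa using h2.symm
    have h2 := hneg (-1)
    rwa [neg_neg, h1, inv_one] at h2
  ext a
  have h1 := hpow 1 a.val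
  rw [hX1, one_pow] at h1
  simpa [X] using h1

omit [Fintype E] in
theorem shift_minimalPeriod (e : E) : S.shift (Function.minimalPeriod S.σ e) e = e := by
  rw [shift, zpow_natCast, ← Equiv.Perm.iterate_eq_pow, Function.iterate_minimalPeriod]

theorem minimalPeriod_pos (e : E) : 0 < Function.minimalPeriod S.σ e := by
  refine Function.IsPeriodicPt.minimalPeriod_pos (n := orderOf S.σ) (orderOf_pos _) ?_
  rw [Function.IsPeriodicPt, Function.IsFixedPt, Equiv.Perm.iterate_eq_pow, pow_orderOf_eq_one,
    Equiv.Perm.one_apply]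

theorem minimalPeriod_le_card (e : E) : Function.minimalPeriod S.σ e ≤ Fintype.card E := by
  have h := Finset.card_le_card_of_injOn (s := Finset.range (Function.minimalPeriod S.σ e))
    (fun i => S.σ^[i] e) (fun _ _ => Finset.mem_univ _)
    (by simpa using Function.iterate_injOn_Iio_minimalPeriod)
  simpa using h

/-- If all subcycles are reached from `e` at cost at most `h`, then all delays on the subcycle of `e`
have cost at most `h` times a power of the logarithm of the number of arcs. -/
theorem lag_of_reach {h R s : ℕ} {e : E} (hreach : ∀ f, S.Reach h e f)
    (hR : Fintype.card E < 2 ^ (R + 1))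
    (hs : 16 * R * (2 * R + 1) * Real.log (Fintype.card E) ≤ s) (z : ℤ) :
    S.Lag (s * (2 * h + 3)) e z := by
  set l := Function.minimalPeriod S.σ e with hl
  have : NeZero l := ⟨(minimalPeriod_pos (S := S) e).ne'⟩
  have hle : l ≤ Fintype.card E := minimalPeriod_le_card (S := S) e
  let D : Set (ZMod l) := {a | ∃ y : ℤ, (y : ZMod l) = a ∧ S.Lag (2 * h + 1) e y}
  have hD : ∀ χ : AddChar (ZMod l) ℂ, χ ≠ 0 → ∃ d ∈ D, 1 / 2 ≤ ‖χ d - 1‖ := by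
    intro χ hχ
    by_contra! hcon
    exact hχ (addChar_eq_zero_of_lag hreach χ fun y hy => hcon _ ⟨y, rfl, hy⟩)
  have hlog : Real.log l ≤ Real.log (Fintype.card E) :=
    Real.log_le_log (by exact_mod_cast minimalPeriod_pos (S := S) e) (by exact_mod_cast hle)
  obtain ⟨g, hg, hsum⟩ := exists_sum_eq_of_addChar hD (R := R) (s := s)
    (by rw [Nat.card_zmod]; omega)
    (by
      rw [Nat.card_zmod]
      exact (mul_le_mul_of_nonneg_left hlog (by positivity)).trans hs) (z : ZMod l)
  have hlift : ∀ j, ∃ y : ℤ, (y : ZMod l) = g j ∧ S.Lag (2 * h + 1) e y := by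
    intro j
    rcases hg j with h1 | h1 | ⟨y, hy, h1⟩
    · exact ⟨0, by simp [h1], (lag_zero e).mono (Nat.zero_le _)⟩
    · exact h1
    · exact ⟨-y, by rw [Int.cast_neg, hy, neg_neg], h1.neg⟩
  choose y hy hlag using hlift
  obtain ⟨j, hj, hn⟩ := lag_sum y hlag
  refine ⟨j, hj, ?_⟩
  have hcast : ((∑ j, y j : ℤ) : ZMod l) = (z : ZMod l) := by
    rw [Int.cast_sum, ← hsum]
    exact Finset.sum_congr rfl fun j _ => hy j
  obtain ⟨q, hq⟩ := (ZMod.intCast_eq_intCast_iff_dvd_sub _ _ l).1 hcast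
  have hfix : ∀ n : ℤ, S.shift (l * n) e = e := fun n => by
    have h1 : (S.σ ^ (l : ℤ)) e = e := shift_minimalPeriod (S := S) e
    rw [shift, zpow_mul]
    exact Equiv.Perm.zpow_apply_eq_self_of_apply_eq_self h1 n
  rwa [show z + j = (∑ j, y j + j) + l * q by rw [← hq]; ring, ← shift_shift, hfix]

end Subcycles

end SymDigraph

/-! ### The graph of subcycles -/

theorem SimpleGraph.Walk.dist_getVert_of_length_eq_dist {Q : Type*} {Γ : SimpleGraph Q}
    (hΓ : Γ.Connected) {u v : Q} (p : Γ.Walk u v) (hp : p.length = Γ.dist u v) {j : ℕ}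
    (hj : j ≤ p.length) : Γ.dist u (p.getVert j) = j := by
  have h1 := SimpleGraph.dist_le (p.take j)
  have h2 := SimpleGraph.dist_le (p.drop j)
  have h3 := hΓ.dist_triangle (u := u) (v := p.getVert j) (w := v)
  rw [SimpleGraph.Walk.take_length] at h1
  rw [SimpleGraph.Walk.drop_length] at h2
  omega

/-- If vertices carry sets that are disjoint for nonadjacent vertices and have at least `q + 1`
elements for all vertices closer to `c` than `c'`, then every second vertex of a geodesic from `c`
to `c'` contributes `q + 1` new elements. -/
theorem SimpleGraph.dist_le_of_disjoint {Q α : Type*} [Fintype α] {Γ : SimpleGraph Q}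
    (hΓ : Γ.Connected) (W : Q → Finset α)
    (hW : ∀ c c', c ≠ c' → ¬ Γ.Adj c c' → Disjoint (W c) (W c')) {q : ℕ}
    (hq : Fintype.card α < (q + 1) * (q + 1)) {c c' : Q}
    (hbig : ∀ x, Γ.dist c x < Γ.dist c c' → q + 1 ≤ (W x).card) : Γ.dist c c' ≤ 2 * q := by
  classical
  obtain ⟨p, hp⟩ := hΓ.exists_walk_length_eq_dist c c'
  set d := Γ.dist c c' with hd
  set a := (d + 1) / 2 with ha
  have hdist : ∀ i ∈ Finset.range a, Γ.dist c (p.getVert (2 * i)) = 2 * i := fun i hi => by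
    rw [Finset.mem_range] at hi
    exact p.dist_getVert_of_length_eq_dist hΓ hp (by omega)
  have hdisj : ((Finset.range a : Finset ℕ) : Set ℕ).PairwiseDisjoint
      fun i => W (p.getVert (2 * i)) := by
    intro i hi j hj hij
    have h1 := hdist i hi
    have h2 := hdist j hj
    refine hW _ _ (fun h => ?_) fun h => ?_
    · rw [h, h2] at h1
      omega
    · have h3 := SimpleGraph.dist_eq_one_iff_adj.2 h
      have h4 := hΓ.dist_triangle (u := c) (v := p.getVert (2 * i)) (w := p.getVert (2 * j))
      have h5 := hΓ.dist_triangle (u := c) (v := p.getVert (2 * j)) (w := p.getVert (2 * i))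
      rw [SimpleGraph.dist_comm (u := p.getVert (2 * j))] at h5
      omega
  have h1 : a * (q + 1) ≤ Fintype.card α := by
    calc a * (q + 1) = ∑ i ∈ Finset.range a, (q + 1) := by simp
      _ ≤ ∑ i ∈ Finset.range a, (W (p.getVert (2 * i))).card := Finset.sum_le_sum fun i hi => by
          refine hbig _ ?_
          rw [hdist i hi]
          rw [Finset.mem_range] at hi
          omega
      _ = ((Finset.range a).biUnion fun i => W (p.getVert (2 * i))).card :=
          (Finset.card_biUnion hdisj).symm
      _ ≤ Fintype.card α := Finset.card_le_univ _
  have h2 : a < q + 1 := lt_of_mul_lt_mul_right (h1.trans_lt hq) (Nat.zero_le _)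
  omega

/-- Either every vertex is close to one with a small set, or the graph has small diameter. -/
theorem SimpleGraph.exists_small_or_dist_le {Q α : Type*} [Fintype α] [Finite Q]
    {Γ : SimpleGraph Q} (hΓ : Γ.Connected) (W : Q → Finset α)
    (hW : ∀ c c', c ≠ c' → ¬ Γ.Adj c c' → Disjoint (W c) (W c')) {q : ℕ}
    (hq : Fintype.card α < (q + 1) * (q + 1)) :
    (∀ c, ∃ y, (W y).card ≤ q ∧ Γ.dist c y ≤ 2 * q) ∨ ∀ c c', Γ.dist c c' ≤ 2 * q := by
  by_cases h : ∃ y, (W y).card ≤ q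
  · left
    intro c
    obtain ⟨y, hy, hmin⟩ := Set.exists_min_image {y | (W y).card ≤ q} (Γ.dist c)
      (Set.toFinite _) h
    refine ⟨y, hy, Γ.dist_le_of_disjoint hΓ W hW hq fun x hx => ?_⟩
    by_contra hlt
    exact absurd (hmin x (by simpa using Nat.le_of_lt_succ (not_le.1 hlt))) (not_le.2 hx)
  · push Not at h
    exact Or.inr fun c c' => Γ.dist_le_of_disjoint hΓ W hW hq fun x _ => h x

namespace SymDigraph

namespace Subcycles

variable {V E : Type*} {G : SymDigraph V E} {S : G.Subcycles}

variable (S) in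
/-- The set of subcycles, that is, of orbits of `σ`. -/
abbrev Cycle : Type _ := Quotient (Equiv.Perm.SameCycle.setoid S.σ)

variable (S) in
/-- The subcycle containing an arc. -/
def cycleMk (e : E) : S.Cycle := Quotient.mk _ e

theorem cycleMk_eq_iff {e f : E} : S.cycleMk e = S.cycleMk f ↔ ∃ i : ℤ, S.shift i e = f :=
  Quotient.eq

theorem cycleMk_shift (i : ℤ) (e : E) : S.cycleMk (S.shift i e) = S.cycleMk e :=
  (cycleMk_eq_iff.2 ⟨i, rfl⟩).symm

variable (S) in
/-- Two different subcycles are adjacent if they pass through a common vertex. -/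
def cycleGraph : SimpleGraph S.Cycle where
  Adj c c' := c ≠ c' ∧ ∃ e f, S.cycleMk e = c ∧ S.cycleMk f = c' ∧ G.src e = G.src f
  symm := ⟨fun _ _ ⟨h, e, f, he, hf, hef⟩ => ⟨h.symm, f, e, hf, he, hef.symm⟩⟩
  loopless := ⟨fun _ h => h.1 rfl⟩

theorem reach_of_walk {c c' : S.Cycle} (p : S.cycleGraph.Walk c c') :
    ∀ e f, S.cycleMk e = c → S.cycleMk f = c' → S.Reach p.length e f := by
  induction p with
  | nil =>
    intro e f he hf
    obtain ⟨i, rfl⟩ := cycleMk_eq_iff.1 (hf.trans he.symm)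
    exact ⟨i, Near.refl _⟩
  | cons h p ih =>
    intro e f he hf
    rw [SimpleGraph.Walk.length_cons]
    obtain ⟨-, a, b, ha, hb, hab⟩ := h
    obtain ⟨i, rfl⟩ := cycleMk_eq_iff.1 (ha.trans he.symm)
    obtain ⟨z, hz⟩ := ih b f hb hf
    refine ⟨i + z, ?_⟩
    have h1 := ((near_of_src (S := S) hab).trans hz).shift i
    rw [shift_shift] at h1
    exact h1.mono (by omega)

theorem cycleGraph_connected (hG : G.Connected) [Nonempty E] : S.cycleGraph.Connected := by
  have hwalk : ∀ {u v : V} (_ : G.toSimple.Walk u v) (e f : E), G.src e = u → G.src f = v →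
      S.cycleGraph.Reachable (S.cycleMk e) (S.cycleMk f) := by
    have hsrc : ∀ e f : E, G.src e = G.src f →
        S.cycleGraph.Reachable (S.cycleMk e) (S.cycleMk f) := fun e f h => by
      by_cases hef : S.cycleMk e = S.cycleMk f
      · rw [hef]
      · exact SimpleGraph.Adj.reachable ⟨hef, e, f, rfl, rfl, h⟩
    intro u v p
    induction p with
    | nil => exact fun e f he hf => hsrc e f (he.trans hf.symm)
    | cons h p ih =>
      intro e f he hf
      obtain ⟨-, a, ha, ha'⟩ := h
      have h1 := ih (S.shift 1 a) f (by rw [shift_one, S.src_σ, ha']) hf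
      rw [cycleMk_shift] at h1
      exact (hsrc e a (he.trans ha.symm)).trans h1
  have : Nonempty S.Cycle := ⟨S.cycleMk (Classical.arbitrary E)⟩
  refine ⟨fun c c' => ?_⟩
  induction c using Quotient.inductionOn with | _ e
  induction c' using Quotient.inductionOn with | _ f
  obtain ⟨p⟩ := hG.preconnected (G.src e) (G.src f)
  exact hwalk p e f rfl rfl

theorem reach_of_dist_le (hG : G.Connected) {h : ℕ} {e f : E}
    (hd : S.cycleGraph.dist (S.cycleMk e) (S.cycleMk f) ≤ h) : S.Reach h e f := by
  have : Nonempty E := ⟨e⟩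
  obtain ⟨p, hp⟩ := (cycleGraph_connected (S := S) hG).exists_walk_length_eq_dist
    (S.cycleMk e) (S.cycleMk f)
  obtain ⟨z, hz⟩ := reach_of_walk p e f rfl rfl
  exact ⟨z, hz.mono (by omega)⟩

variable [Fintype E]

open Classical in
variable (S) in
/-- The arcs of a subcycle. -/
noncomputable def arcs (c : S.Cycle) : Finset E := Finset.univ.filter fun e => S.cycleMk e = c

theorem mem_arcs {c : S.Cycle} {e : E} : e ∈ S.arcs c ↔ S.cycleMk e = c := by
  simp [arcs]

/-- Sums over a subcycle dominate sums over one turn, since no arc is repeated within a turn. -/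
theorem sum_range_minimalPeriod_le (e : E) (g : E → ℕ) :
    ∑ i ∈ Finset.range (Function.minimalPeriod S.σ e), g (S.shift i e) ≤
      ∑ f ∈ S.arcs (S.cycleMk e), g f := by
  classical
  have hinj : Set.InjOn (fun i : ℕ => S.shift i e)
      (Finset.range (Function.minimalPeriod S.σ e) : Set ℕ) := by
    have h := Function.iterate_injOn_Iio_minimalPeriod (f := S.σ) (x := e)
    intro i hi j hj hij
    refine h (by simpa using hi) (by simpa using hj) ?_
    simpa [shift, Equiv.Perm.iterate_eq_pow] using hij
  rw [← Finset.sum_image (f := g) hinj]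
  refine Finset.sum_le_sum_of_subset fun f hf => ?_
  obtain ⟨i, -, rfl⟩ := Finset.mem_image.1 hf
  exact mem_arcs.2 (cycleMk_shift i e)

theorem minimalPeriod_le_card_arcs (e : E) :
    Function.minimalPeriod S.σ e ≤ (S.arcs (S.cycleMk e)).card := by
  simpa using sum_range_minimalPeriod_le (S := S) e fun _ => 1

/-- A subcycle of length `l` carries `l k / m` tokens, so that `l` is a multiple of
`m / gcd k m`. -/
theorem card_cycle_le_gcd (hG : G.Connected) (hk : 1 ≤ ∑ f, S.w f) :
    Nat.card S.Cycle ≤ Nat.gcd (∑ f, S.w f) (Fintype.card E) := by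
  classical
  have := Fintype.ofFinite S.Cycle
  set k := ∑ f, S.w f with hk_def
  set m := Fintype.card E with hm_def
  rcases Nat.eq_zero_or_pos m with hm | hm
  · have : IsEmpty E := Fintype.card_eq_zero_iff.1 hm
    have : k = 0 := by simp [hk_def]
    omega
  obtain ⟨m', k', hcop, hm', hk'⟩ := Nat.exists_coprime m k
  rw [Nat.gcd_comm] at hm' hk'
  set g := Nat.gcd k m with hg
  have hgpos : 0 < g := Nat.gcd_pos_of_pos_left _ hk
  have hm'pos : 0 < m' := by
    rcases Nat.eq_zero_or_pos m' with h | h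
    · rw [h, zero_mul] at hm'
      omega
    · exact h
  have hcyc : ∀ c : S.Cycle, m' ≤ (S.arcs c).card := by
    intro c
    induction c using Quotient.inductionOn with | _ e
    refine le_trans (Nat.le_of_dvd (minimalPeriod_pos e) ?_) (minimalPeriod_le_card_arcs (S := S) e)
    have h1 := card_mul_win (S := S) hG (shift_minimalPeriod e)
    rw [← hk_def, ← hm_def] at h1
    refine hcop.dvd_of_dvd_mul_right ⟨S.win (Function.minimalPeriod S.σ e) e, ?_⟩
    apply Nat.eq_of_mul_eq_mul_right hgpos
    calc Function.minimalPeriod S.σ e * k' * g = Function.minimalPeriod S.σ e * (k' * g) := by ring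
      _ = m * S.win (Function.minimalPeriod S.σ e) e := by rw [← hk', h1]
      _ = m' * g * S.win (Function.minimalPeriod S.σ e) e := by rw [← hm']
      _ = _ := by ring
  have hsum : ∑ c : S.Cycle, (S.arcs c).card = m := by
    rw [hm_def, ← Finset.card_univ, Finset.card_eq_sum_card_fiberwise (f := S.cycleMk)
      (t := Finset.univ) fun _ _ => Finset.mem_coe.2 (Finset.mem_univ _)]
    exact Finset.sum_congr rfl fun c _ => by simp only [arcs]
  have h1 : Fintype.card S.Cycle * m' ≤ m := by
    rw [← hsum, ← smul_eq_mul, ← Finset.card_univ]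
    exact Finset.card_nsmul_le_sum _ _ _ fun c _ => hcyc c
  rw [Nat.card_eq_fintype_card]
  apply le_of_mul_le_mul_right _ hm'pos
  rwa [mul_comm g, ← hm']

theorem reach_gcd (hG : G.Connected) (hk : 1 ≤ ∑ f, S.w f) (e f : E) :
    S.Reach (Nat.gcd (∑ f, S.w f) (Fintype.card E)) e f := by
  classical
  have : Nonempty E := ⟨e⟩
  have := Fintype.ofFinite S.Cycle
  refine reach_of_dist_le hG ?_
  obtain ⟨p, hp, hp'⟩ := (cycleGraph_connected (S := S) hG).exists_path_of_dist
    (S.cycleMk e) (S.cycleMk f)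
  have h1 := hp.length_lt
  have h2 := card_cycle_le_gcd (S := S) hG hk
  rw [Nat.card_eq_fintype_card] at h2
  omega

/-! ### Subcycles with few tokens or few vertices -/

/-- Windows of one length on a closed subcycle walk differ by at most the tokens of one turn. -/
theorem near_shift_of_period {l : ℕ} {f : E} (hl : 0 < l) (h : S.shift l f = f) (z : ℤ) :
    S.Near (S.win l f) f (S.shift z f) := by
  have key : ∀ (y : ℤ) (Δ : ℕ), Δ / l * S.win l f ≤ S.win Δ (S.shift y f) ∧
      S.win Δ (S.shift y f) ≤ Δ / l * S.win l f + S.win l f := by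
    intro y Δ
    have h1 : S.shift l (S.shift y f) = S.shift y f := shift_shift_eq h y
    have h2 : S.win Δ (S.shift y f) = Δ / l * S.win l f +
        S.win (Δ % l) (S.shift (Δ / l * l : ℕ) (S.shift y f)) := by
      conv_lhs => rw [← Nat.div_add_mod' Δ l]
      rw [win_add, win_mul h1, win_shift_of_shift_eq h]
    have h3 : S.win (Δ % l) (S.shift (Δ / l * l : ℕ) (S.shift y f)) ≤ S.win l f := by
      refine (win_mono S (Nat.mod_lt _ hl).le _).trans ?_
      rw [shift_shift, win_shift_of_shift_eq h]
    omega
  intro y Δ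
  have h1 := key y Δ
  have h2 := key (y + z) Δ
  rw [shift_shift]
  omega

/-- All delays cost polylogarithmically many times the square root of the number of tokens: on a
subcycle with at most `q` tokens every delay costs at most `q`, and without such a subcycle nearby
the graph of subcycles has diameter at most `2 q`. -/
theorem lag_of_tokens (hG : G.Connected) {q R s : ℕ} (hq : ∑ f, S.w f < (q + 1) * (q + 1))
    (hR : Fintype.card E < 2 ^ (R + 1))
    (hs : 16 * R * (2 * R + 1) * Real.log (Fintype.card E) ≤ s) (e : E) (z : ℤ) :
    S.Lag (s * (4 * q + 3) + 7 * q) e z := by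
  classical
  have : Nonempty E := ⟨e⟩
  let W : S.Cycle → Finset (Σ e : E, Fin (S.w e)) := fun c => (S.arcs c).sigma fun _ => Finset.univ
  have hW : ∀ c c', c ≠ c' → ¬ S.cycleGraph.Adj c c' → Disjoint (W c) (W c') := by
    intro c c' hc _
    rw [Finset.disjoint_left]
    rintro ⟨a, t⟩ h1 h2
    rw [Finset.mem_sigma, mem_arcs] at h1 h2
    exact hc (h1.1.symm.trans h2.1)
  rcases SimpleGraph.exists_small_or_dist_le (cycleGraph_connected (S := S) hG) W hW (q := q)
    (by simpa using hq) with h | h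
  · obtain ⟨y, hy, hd⟩ := h (S.cycleMk e)
    induction y using Quotient.inductionOn with | _ f
    have h1 : S.win (Function.minimalPeriod S.σ f) f ≤ q := by
      refine (sum_range_minimalPeriod_le (S := S) f S.w).trans (le_trans (le_of_eq ?_) hy)
      simp only [W, Finset.card_sigma, Finset.card_univ, Fintype.card_fin]
      rfl
    have h2 : S.Lag q f z := ⟨0, by simp, by
      simpa using (near_shift_of_period (minimalPeriod_pos f) (shift_minimalPeriod f) z).mono h1⟩
    refine ((reach_of_dist_le hG hd).lag h2).mono ?_
    have := Nat.zero_le (s * (4 * q + 3))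
    omega
  · refine (lag_of_reach (fun f => reach_of_dist_le hG (h _ _)) hR hs z).mono ?_
    rw [show 2 * (2 * q) = 4 * q by ring]
    omega

omit [Fintype E] in
/-- Steps of two along a subcycle cost `2`, but returning to a vertex already visited costs only
`1`. So the cost of an even delay is bounded by the number of vertices visited. -/
theorem near_shift_of_card_le [DecidableEq V] {f : E} {n : ℕ} (F : Finset V) :
    ∀ i ≤ n, (∀ j, i ≤ j → j ≤ n → G.src (S.shift (2 * j : ℕ) f) ∈ F) →
      S.Near (3 * F.card) (S.shift (2 * i : ℕ) f) (S.shift (2 * n : ℕ) f) := by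
  induction F using Finset.strongInduction with
  | H F ih =>
    intro i hi hF
    have hiF := hF i le_rfl hi
    set v := G.src (S.shift (2 * i : ℕ) f) with hv
    -- the last visit of the source of the starting arc
    set j := Nat.findGreatest (fun j => i ≤ j ∧ G.src (S.shift (2 * j : ℕ) f) = v) n
    have hj : i ≤ j ∧ G.src (S.shift (2 * j : ℕ) f) = v :=
      Nat.findGreatest_spec (P := fun j => i ≤ j ∧ G.src (S.shift (2 * j : ℕ) f) = v) hi
        ⟨le_rfl, rfl⟩
    have hjn : j ≤ n := Nat.findGreatest_le _
    have hlast : ∀ j', j < j' → j' ≤ n → G.src (S.shift (2 * j' : ℕ) f) ≠ v := fun j' h1 h2 h3 =>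
      Nat.findGreatest_is_greatest
        (P := fun j => i ≤ j ∧ G.src (S.shift (2 * j : ℕ) f) = v) h1 h2 ⟨by omega, h3⟩
    have hcard : (F.erase v).card + 1 = F.card := Finset.card_erase_add_one hiF
    have h1 : S.Near 1 (S.shift (2 * i : ℕ) f) (S.shift (2 * j : ℕ) f) := near_of_src hj.2.symm
    rcases hjn.eq_or_lt with h2 | h2
    · rw [h2] at h1
      exact h1.mono (by omega)
    · have h3 := near_shift_two (S := S) (S.shift (2 * j : ℕ) f)
      rw [shift_shift, show (2 : ℤ) + (2 * j : ℕ) = (2 * (j + 1) : ℕ) by push_cast; ring] at h3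
      have h4 := ih (F.erase v) (Finset.erase_ssubset hiF) (j + 1) h2 fun j' h5 h6 =>
        Finset.mem_erase.2 ⟨hlast j' (by omega) h6, hF j' (by omega) h6⟩
      exact ((h1.trans h3).trans h4).mono (by omega)

/-- The counterpart of `lag_of_tokens` for the number of vertices: on a subcycle through at most `q`
vertices every even delay costs at most `3 q`. -/
theorem lag_of_vertices [Fintype V] (hG : G.Connected) {q R s : ℕ}
    (hq : Fintype.card V < (q + 1) * (q + 1))
    (hR : Fintype.card E < 2 ^ (R + 1))
    (hs : 16 * R * (2 * R + 1) * Real.log (Fintype.card E) ≤ s) (e : E) (z : ℤ) :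
    S.Lag (s * (4 * q + 3) + 7 * q) e z := by
  classical
  have : Nonempty E := ⟨e⟩
  let W : S.Cycle → Finset V := fun c => (S.arcs c).image G.src
  have hW : ∀ c c', c ≠ c' → ¬ S.cycleGraph.Adj c c' → Disjoint (W c) (W c') := by
    intro c c' hc hadj
    rw [Finset.disjoint_left]
    intro v h1 h2
    obtain ⟨a, ha, rfl⟩ := Finset.mem_image.1 h1
    obtain ⟨b, hb, hab⟩ := Finset.mem_image.1 h2
    exact hadj ⟨hc, a, b, mem_arcs.1 ha, mem_arcs.1 hb, hab.symm⟩
  rcases SimpleGraph.exists_small_or_dist_le (cycleGraph_connected (S := S) hG) W hW (q := q) hq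
    with h | h
  · obtain ⟨y, hy, hd⟩ := h (S.cycleMk e)
    induction y using Quotient.inductionOn with | _ f
    have heven : ∀ n : ℕ, S.Near (3 * q) f (S.shift (2 * n : ℕ) f) := fun n => by
      have h1 := near_shift_of_card_le (S := S) (f := f) (n := n) (W (S.cycleMk f)) 0 (Nat.zero_le _)
        fun j _ _ => Finset.mem_image_of_mem _ (mem_arcs.2 (cycleMk_shift _ f))
      have h2 : (W (S.cycleMk f)).card ≤ q := hy
      simp only [mul_zero, Nat.cast_zero, shift_zero] at h1
      exact h1.mono (by omega)
    have h2 : S.Lag (3 * q) f z := by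
      obtain ⟨n, hn⟩ := exists_shift_nat (S := S) z f
      rcases Nat.even_or_odd' n with ⟨a, ha | ha⟩
      · refine ⟨0, by simp, ?_⟩
        rw [add_zero, hn, ha]
        exact heven a
      · refine ⟨-1, by simp, ?_⟩
        rw [add_comm, ← shift_shift, hn, ha, shift_shift,
          show (-1 : ℤ) + (2 * a + 1 : ℕ) = (2 * a : ℕ) by push_cast; ring]
        exact heven a
    refine ((reach_of_dist_le hG hd).lag h2).mono ?_
    have := Nat.zero_le (s * (4 * q + 3))
    omega
  · refine (lag_of_reach (fun f => reach_of_dist_le hG (h _ _)) hR hs z).mono ?_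
    rw [show 2 * (2 * q) = 4 * q by ring]
    omega

end Subcycles

end SymDigraph

/-! ### Idleness bounds -/

namespace SymDigraph

theorem toENNReal_le_ofReal_of_le {i : ℕ∞} {D : ℕ} {b : ℝ} (h : i ≤ D) (hb : (D : ℝ) ≤ b) :
    (i : ℝ≥0∞) ≤ ENNReal.ofReal b := by
  calc (i : ℝ≥0∞) ≤ ((D : ℕ∞) : ℝ≥0∞) := ENat.toENNReal_le.2 h
    _ = ENNReal.ofReal D := by rw [ENat.toENNReal_coe, ENNReal.ofReal_natCast]
    _ ≤ ENNReal.ofReal b := ENNReal.ofReal_le_ofReal hb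

theorem RoundRobin.idleness_le_of_lag {V E : Type*} [Fintype E] {G : SymDigraph V E}
    (R : G.RoundRobin) (x : G.State) {S : G.Subcycles} {T r : ℕ}
    (hS : ∀ t e, R.loadAt x (T + t) e = S.w (S.shift (-t) e)) (hG : G.Connected)
    (hk : 1 ≤ ∑ e, S.w e) (hkm : ∑ e, S.w e ≤ Fintype.card E) (hr : ∀ e z, S.Lag r e z) {b : ℝ}
    (hb : ((r : ℝ) + 3) * ((Fintype.card E : ℝ) / (∑ e, S.w e : ℕ)) ≤ b) :
    (R.idleness x : ℝ≥0∞) ≤ ENNReal.ofReal b := by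
  refine toENNReal_le_ofReal_of_le
    (R.idleness_le_of_win x hS fun e => Subcycles.one_le_win_of_lag hG hk (hr e)) ?_
  refine le_trans ?_ hb
  have hk' : (0 : ℝ) < (∑ e, S.w e : ℕ) := by exact_mod_cast hk
  have h1 : 1 ≤ (Fintype.card E : ℝ) / (∑ e, S.w e : ℕ) := by
    rw [one_le_div hk']
    exact_mod_cast hkm
  have h2 : ((r * Fintype.card E / (∑ e, S.w e) : ℕ) : ℝ) ≤
      (r : ℝ) * ((Fintype.card E : ℝ) / (∑ e, S.w e : ℕ)) := by
    refine Nat.cast_div_le.trans (le_of_eq ?_)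
    push_cast
    ring
  push_cast at h1 h2 ⊢
  linarith

/-- The two parameters of the additive argument, and the size of the resulting cost. -/
theorem exists_log_parameters {m : ℕ} (hm : 1 ≤ m) : ∃ R s : ℕ, m < 2 ^ (R + 1) ∧
    16 * R * (2 * R + 1) * Real.log m ≤ s ∧ (s : ℝ) ≤ 161 * (1 + Real.log m) ^ 3 := by
  have hlog : 0 ≤ Real.log m := Real.log_natCast_nonneg m
  set Y := 1 + Real.log m with hY
  have hR : ((Nat.log 2 m : ℕ) : ℝ) ≤ 2 * Y := by
    have h1 : (2 : ℝ) ^ Nat.log 2 m ≤ m := by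
      exact_mod_cast Nat.pow_log_le_self 2 (by omega : m ≠ 0)
    have h2 := Real.log_le_log (by positivity) h1
    rw [Real.log_pow] at h2
    have h3 := Real.log_two_gt_d9
    have h4 : (0 : ℝ) ≤ (Nat.log 2 m : ℕ) := Nat.cast_nonneg _
    nlinarith
  refine ⟨Nat.log 2 m, ⌈16 * (Nat.log 2 m : ℝ) * (2 * Nat.log 2 m + 1) * Real.log m⌉₊,
    Nat.lt_pow_succ_log_self (by norm_num) m, Nat.le_ceil _, ?_⟩
  refine (Nat.ceil_lt_add_one (by positivity)).le.trans ?_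
  have h4 : (0 : ℝ) ≤ (Nat.log 2 m : ℕ) := Nat.cast_nonneg _
  have hY1 : 1 ≤ Y := by linarith
  have h5 : 16 * (Nat.log 2 m : ℝ) * (2 * Nat.log 2 m + 1) * Real.log m ≤
      16 * (2 * Y) * (5 * Y) * Y := by
    gcongr <;> linarith
  have h6 : 1 ≤ Y ^ 3 := one_le_pow₀ hY1
  nlinarith

end SymDigraph

theorem proposition5p3 :
    ∃ (C : ℝ) (p : ℕ), ∀ (V E : Type*) [Fintype V] [Fintype E] (G : SymDigraph V E)
      (R : G.RoundRobin) (x : G.State) (n m k : ℕ),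
      n = Fintype.card V → m = Fintype.card E → k = x.total →
      G.Connected → 1 ≤ k → k ≤ m →
      (¬ G.IsBipartite →
        (R.idleness x : ℝ≥0∞) ≤
            ENNReal.ofReal (C * (1 + Real.log m) ^ p * ((m : ℝ) / k * (Nat.gcd k m : ℝ))) ∧
        (R.idleness x : ℝ≥0∞) ≤
            ENNReal.ofReal (C * ((m : ℝ) / k * ((max 1 G.diam : ℕ) : ℝ))) ∧
        (R.idleness x : ℝ≥0∞) ≤
            ENNReal.ofReal (C * (1 + Real.log m) ^ p * ((m : ℝ) / k * Real.sqrt n)) ∧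
        ((k : ℝ) > 3 / 4 * (m : ℝ) → R.idleness x ≤ 4) ∧
        (R.idleness x : ℝ≥0∞) ≤
            ENNReal.ofReal (C * (1 + Real.log m) ^ p * ((m : ℝ) / k * Real.sqrt k))) ∧
      (G.IsTree →
        (R.idleness x : ℝ≥0∞) ≤ ENNReal.ofReal (C * ((m : ℝ) / k))) := by
  refine ⟨2000, 3, fun V E _ _ G R x n m k hn hm hk hG hk1 hkm => ?_⟩
  obtain ⟨S, T, hw, hS⟩ := R.exists_subcycles x
  rw [← hk] at hw
  have hk1' : 1 ≤ ∑ e, S.w e := by omega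
  have hkm' : ∑ e, S.w e ≤ Fintype.card E := by omega
  obtain ⟨a, s, ha, hs, hs'⟩ := SymDigraph.exists_log_parameters (hk1.trans hkm)
  rw [hm] at ha hs
  have hbound := fun r b => R.idleness_le_of_lag x hS hG hk1' hkm' (r := r) (b := b)
  simp only [hw, ← hm] at hbound
  have hkpos : (0 : ℝ) < k := by exact_mod_cast hk1
  have hd : 1 ≤ (m : ℝ) / k := by
    rw [one_le_div hkpos]
    exact_mod_cast hkm
  set Y := (1 + Real.log m) ^ 3 with hY
  have hY1 : 1 ≤ Y := one_le_pow₀ (by linarith [Real.log_natCast_nonneg m])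
  -- the cost found for `q ^ 2 ≤ j < (q + 1) ^ 2` is of the right order
  have hsqrt : ∀ j : ℕ, 1 ≤ j →
      (((s * (4 * j.sqrt + 3) + 7 * j.sqrt : ℕ) : ℝ) + 3) * ((m : ℝ) / k) ≤
        2000 * Y * ((m : ℝ) / k * Real.sqrt j) := by
    intro j hj
    have h1 : (1 : ℝ) ≤ j.sqrt := by exact_mod_cast Nat.sqrt_pos.2 hj
    have h2 : (j.sqrt : ℝ) ≤ Real.sqrt j := Real.nat_sqrt_le_real_sqrt
    have h3 : ((s * (4 * j.sqrt + 3) + 7 * j.sqrt : ℕ) : ℝ) + 3 ≤ 2000 * Y * Real.sqrt j := by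
      have h4 : (s : ℝ) * (4 * j.sqrt + 3) ≤ 161 * Y * (7 * j.sqrt) := by
        gcongr
        linarith
      have h5 : (j.sqrt : ℝ) ≤ Y * j.sqrt := le_mul_of_one_le_left (by linarith) hY1
      have h6 : Y * j.sqrt ≤ Y * Real.sqrt j := mul_le_mul_of_nonneg_left h2 (by linarith)
      push_cast
      nlinarith
    calc _ ≤ 2000 * Y * Real.sqrt j * ((m : ℝ) / k) := by gcongr
      _ = _ := by ring
  refine ⟨fun _ => ⟨?_, ?_, ?_, fun h => ?_, ?_⟩, fun hT => ?_⟩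
  · refine hbound (s * (2 * Nat.gcd k m + 3)) _ (fun e z => ?_) ?_
    · have h1 := SymDigraph.Subcycles.reach_gcd hG hk1' e
      rw [hw, ← hm] at h1
      exact SymDigraph.Subcycles.lag_of_reach h1 ha hs z
    · have h1 : (1 : ℝ) ≤ Nat.gcd k m := by exact_mod_cast Nat.gcd_pos_of_pos_left m hk1
      have h2 : ((s * (2 * Nat.gcd k m + 3) : ℕ) : ℝ) + 3 ≤ 2000 * Y * Nat.gcd k m := by
        have h3 : (s : ℝ) * (2 * Nat.gcd k m + 3) ≤ 161 * Y * (5 * Nat.gcd k m) := by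
          gcongr
          linarith
        push_cast
        nlinarith
      calc _ ≤ 2000 * Y * Nat.gcd k m * ((m : ℝ) / k) := by gcongr
        _ = _ := by ring
  · refine hbound (2 * G.diam + 1) _ (SymDigraph.Subcycles.lag_diam hG) ?_
    have h1 : (G.diam : ℝ) ≤ (max 1 G.diam : ℕ) := by exact_mod_cast le_max_right _ _
    have h2 : (1 : ℝ) ≤ (max 1 G.diam : ℕ) := by exact_mod_cast le_max_left _ _
    calc _ ≤ (2000 * ((max 1 G.diam : ℕ) : ℝ)) * ((m : ℝ) / k) := by
          refine mul_le_mul_of_nonneg_right ?_ (by linarith)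
          rw [Nat.cast_add, Nat.cast_mul, Nat.cast_one, Nat.cast_ofNat]
          linarith
      _ = _ := by ring
  · have hn1 : 1 ≤ n := by
      have := hG.nonempty
      rw [hn]
      exact Fintype.card_pos
    exact hbound _ _ (SymDigraph.Subcycles.lag_of_vertices hG (hn ▸ Nat.lt_succ_sqrt n) ha hs)
      (hsqrt n hn1)
  · refine R.idleness_le_of_win x hS fun e => SymDigraph.Subcycles.one_le_win_four hG ?_ e
    rw [hw, ← hm]
    have h1 : 3 * (m : ℝ) < 4 * k := by linarith
    exact_mod_cast h1
  · exact hbound _ _ (SymDigraph.Subcycles.lag_of_tokens hG (hw ▸ Nat.lt_succ_sqrt k) ha hs)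
      (hsqrt k hk1)
  · refine SymDigraph.toENNReal_le_ofReal_of_le (R.idleness_le_of_win x hS fun e =>
      SymDigraph.Subcycles.one_le_win_of_isTree hT hk1' e) ?_
    rw [hw, ← hm]
    have h1 : ((m / k : ℕ) : ℝ) ≤ (m : ℝ) / k := Nat.cast_div_le
    push_cast
    linarith
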